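/- Let $\Omega\subseteq\mathbb R^3$ be a strong Lipschitz domain: $\Omega$ is open and for every $p\in\partial\Omega$ there are $\epsilon,h>0$, a plane $W$ with orthonormal basis $w_1,w_2$ and unit normal $v$, and a Lipschitz function $a\colon B_\epsilon(0)\subseteq\mathbb R^2\to(-\tfrac h2,\tfrac h2)$ such that, with $C=\{p+x_1w_1+x_2w_2+sv : x\in B_\epsilon(0),\ -h<s<h\}$, $$\partial\Omega\cap C=\{p+x_1w_1+x_2w_2+a(x)v : x\in B_\epsilon(0)\},\qquad \Omega\cap C=\{p+x_1w_1+x_2w_2+sv : x\in B_\epsilon(0),\ -h<s<a(x)\}.$$ A strong Lipschitz chart $k\colon\Gamma\to U$ is given by such data and a nonempty open $U\subseteq B_\epsilon(0)$, through $k^{-1}(x)=p+x_1w_1+x_2w_2+a(x)v$ and $\Gamma=k^{-1}(U)$. The surface measure of $\partial\Omega$ is given on $\Gamma$ by $\Upsilon\mapsto\int_{k(\Upsilon)}\sqrt{\det((Dk^{-1})^{\mathsf T}Dk^{-1})}\,d\lambda$, and the outer unit normal by $\nu\circ k^{-1}=(1+\|\nabla a\|^2)^{-1/2}(-\partial_1a\,w_1-\partial_2a\,w_2+v)$.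 All functions are real-valued, or all are complex-valued. - $H^1(\partial\Omega)$ is the set of $f\in L^2(\partial\Omega)$ such that $f\circ k^{-1}\in H^1(U)$ for every strong Lipschitz chart $k\colon\Gamma\to U$. The tangential gradient of such an $f$ is given on each $\Gamma$ by $(\nabla_\tau f)\circ k^{-1}=\big((Dk^{-1})^\dagger\big)^{\mathsf T}\nabla(f\circ k^{-1})$, where $A^\dagger=(A^{\mathsf T}A)^{-1}A^{\mathsf T}$. - $\tilde H^1(\partial\Omega)$ is the set of $f\in L^2(\partial\Omega)$ for which there is a $q\in L^2_\tau(\partial\Omega)=\{q\in L^2(\partial\Omega)^3 : \nu\cdot q=0\text{ a.e.}\}$ with $$\langle q,\nu\times\Phi\rangle_{L^2(\partial\Omega)}=\langle f,\nu\cdot\operatorname{rot}\Phi\rangle_{L^2(\partial\Omega)}\qquad\text{for all }\Phi\in C_c^\infty(\mathbb R^3)^3;$$ one then writes $\tilde\nabla_\tau f=q$. Then: 1. If $\partial\Omega$ is compact, then $\tilde H^1(\partial\Omega)=H^1(\partial\Omega)$. 2. Without any compactness assumption, $\tilde H^1(\partial\Omega)=\{f\in H^1(\partial\Omega) : \nabla_\tau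 f\in L^2(\partial\Omega)^3\}$. 3. For every $f\in\tilde H^1(\partial\Omega)$ both tangential gradients exist in $L^2(\partial\Omega)^3$, are unique, and coincide: $\tilde\nabla_\tau f=\nabla_\tau f$. -/

import Mathlib

open MeasureTheory Set
open scoped ContDiff ENNReal NNReal Matrix

noncomputable section

namespace LipBdry

/-- The Euclidean plane. -/
abbrev E2 : Type := EuclideanSpace ℝ (Fin 2)

/-- Euclidean three-space. -/
abbrev E3 : Type := EuclideanSpace ℝ (Fin 3)

/-- The standard basis vectors of the plane. -/
def e2 (i : Fin 2) : E2 := EuclideanSpace.single i 1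

/-- The standard basis vectors of three-space. -/
def e3 (i : Fin 3) : E3 := EuclideanSpace.single i 1

/-! ### Strong Lipschitz domains -/

/-- The local description of `Ω` near a point `p` as the region below the graph of a Lipschitz
function `a`: `w 0, w 1` is an orthonormal basis of the hyperplane `W`, `v` is a unit normal vector
of `W`, and the point `p + x 0 • w 0 + x 1 • w 1` of `(p + W) ∩ B_ε(p)` is given by its coordinates
`x` in the ball of radius `ε` about `0` in the plane. -/
structure GraphPatch (Ω : Set E3) (p : E3) where
  w : Fin 2 → E3
  v : E3
  orthonormal_w : Orthonormal ℝ w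
  norm_v : ‖v‖ = 1
  inner_w_v : ∀ i, inner ℝ (w i) v = 0
  ε : ℝ
  h : ℝ
  ε_pos : 0 < ε
  h_pos : 0 < h
  a : E2 → ℝ
  lipschitz_a : ∃ K : ℝ≥0, LipschitzOnWith K a (Metric.ball 0 ε)
  abs_a_lt : ∀ x ∈ Metric.ball (0 : E2) ε, |a x| < h / 2
  frontier_inter :
    frontier Ω ∩ {z | ∃ x ∈ Metric.ball (0 : E2) ε, ∃ s ∈ Ioo (-h) h,
        z = p + x 0 • w 0 + x 1 • w 1 + s • v}
      = {z | ∃ x ∈ Metric.ball (0 : E2) ε, z = p + x 0 • w 0 + x 1 • w 1 + a x • v}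
  domain_inter :
    Ω ∩ {z | ∃ x ∈ Metric.ball (0 : E2) ε, ∃ s ∈ Ioo (-h) h,
        z = p + x 0 • w 0 + x 1 • w 1 + s • v}
      = {z | ∃ x ∈ Metric.ball (0 : E2) ε, ∃ s ∈ Ioo (-h) (a x),
        z = p + x 0 • w 0 + x 1 • w 1 + s • v}

/-- `Ω` is a strong Lipschitz domain: an open set that near each of its boundary points is the
region below the graph of a Lipschitz function. Neither connectedness nor boundedness is asked. -/
def IsStrongLipschitzDomain (Ω : Set E3) : Prop :=
  IsOpen Ω ∧ ∀ p ∈ frontier Ω, Nonempty (GraphPatch Ω p)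

/-! ### Charts -/

/-- A strong Lipschitz chart of `∂Ω`: a graph patch at a boundary point `p`, possibly restricted to
a nonempty open set `U` of parameters in the ball `B_ε(0)`. -/
structure Chart (Ω : Set E3) where
  p : E3
  p_mem : p ∈ frontier Ω
  patch : GraphPatch Ω p
  U : Set E2
  isOpen_U : IsOpen U
  U_nonempty : U.Nonempty
  U_subset : U ⊆ Metric.ball 0 patch.ε

namespace Chart

variable {Ω : Set E3}

/-- The inverse chart `k⁻¹`, of which only the values on `U` matter. -/
def inv (k : Chart Ω) (x : E2) : E3 :=
  k.p + x 0 • k.patch.w 0 + x 1 • k.patch.w 1 + k.patch.a x • k.patch.v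

/-- The chart domain `Γ = k⁻¹(U)`. -/
def dom (k : Chart Ω) : Set E3 := k.inv '' k.U

/-- The chart `k(ζ) = Wᵀ (ζ - p)`. -/
def coord (k : Chart Ω) (ζ : E3) : E2 :=
  !₂[inner ℝ (k.patch.w 0) (ζ - k.p), inner ℝ (k.patch.w 1) (ζ - k.p)]

/-- The Jacobian matrix `D k⁻¹` at `x`, defined for almost every `x ∈ U`. -/
def jac (k : Chart Ω) (x : E2) : Matrix (Fin 3) (Fin 2) ℝ :=
  Matrix.of fun i j => fderiv ℝ k.inv x (e2 j) i

/-- The Moore-Penrose inverse `(AᵀA)⁻¹Aᵀ` of the Jacobian matrix `A = D k⁻¹` at `x`. -/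
def pinv (k : Chart Ω) (x : E2) : Matrix (Fin 2) (Fin 3) ℝ :=
  ((k.jac x)ᵀ * k.jac x)⁻¹ * (k.jac x)ᵀ

/-- The surface measure on the chart domain:
`Υ ↦ ∫_{k(Υ)} √(det ((D k⁻¹)ᵀ D k⁻¹)) dλ`. -/
def measure (k : Chart Ω) : Measure E3 :=
  ((volume.restrict k.U).withDensity
    fun x => ENNReal.ofReal (Real.sqrt ((k.jac x)ᵀ * k.jac x).det)).map k.inv

/-- The unit normal at `k⁻¹(x)` in the direction of `v`, which points out of `Ω`. -/
def normal (k : Chart Ω) (x : E2) : E3 :=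
  (Real.sqrt (1 + fderiv ℝ k.patch.a x (e2 0) ^ 2 + fderiv ℝ k.patch.a x (e2 1) ^ 2))⁻¹ •
    (-(fderiv ℝ k.patch.a x (e2 0)) • k.patch.w 0
      - fderiv ℝ k.patch.a x (e2 1) • k.patch.w 1 + k.patch.v)

end Chart

/-! ### Surface measure and normal vector -/

/-- A sequence of charts whose domains cover `∂Ω`. -/
def IsAtlas {Ω : Set E3} (c : ℕ → Chart Ω) : Prop := frontier Ω ⊆ ⋃ n, (c n).dom

open Classical in
/-- The surface measure of `∂Ω`: the boundary is partitioned into countably many pieces, each of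
which lies in a chart domain and carries the measure of that chart. It does not depend on the
sequence of charts. A strong Lipschitz domain with nonempty boundary has such a sequence; when
there is none (in particular when `∂Ω` is empty) the value is zero. -/
def surfaceMeasure (Ω : Set E3) : Measure E3 :=
  if H : ∃ c : ℕ → Chart Ω, IsAtlas c then
    Measure.sum fun n =>
      (H.choose n).measure.restrict (disjointed (fun m => (H.choose m).dom) n)
  else 0

open Classical in
/-- The outer unit normal `ν` of `∂Ω`. On each piece of the partition it is given by the chart;
up to null sets it does not depend on the sequence of charts. -/
def normal (Ω : Set E3) (ζ : E3) : E3 :=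
  if H : ∃ c : ℕ → Chart Ω, IsAtlas c then
    if h : ∃ n, ζ ∈ (H.choose n).dom then
      (H.choose (Nat.find h)).normal ((H.choose (Nat.find h)).coord ζ)
    else 0
  else 0

/-! ### Vector calculus with real or complex scalars -/

section Fields

variable (𝕜 : Type*) [RCLike 𝕜]

/-- The space `𝕜³` with the Euclidean norm. -/
abbrev V3 : Type _ := EuclideanSpace 𝕜 (Fin 3)

/-- The space `𝕜²` with the Euclidean norm. -/
abbrev V2 : Type _ := EuclideanSpace 𝕜 (Fin 2)

variable {𝕜}

/-- The bilinear product `n · z` of a real vector and a vector in `𝕜³`. -/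
def dotV (n : E3) (z : V3 𝕜) : 𝕜 := ∑ i, (n i : 𝕜) * z i

/-- The cross product `n × z` of a real vector and a vector in `𝕜³`. -/
def crossV (n : E3) (z : V3 𝕜) : V3 𝕜 :=
  WithLp.toLp 2 (crossProduct (fun i => (n i : 𝕜)) (fun i => z i))

/-- The rotation (curl) of a vector field on three-space. -/
def rot (Φ : E3 → V3 𝕜) (ζ : E3) : V3 𝕜 :=
  !₂[fderiv ℝ Φ ζ (e3 1) 2 - fderiv ℝ Φ ζ (e3 2) 1,
    fderiv ℝ Φ ζ (e3 2) 0 - fderiv ℝ Φ ζ (e3 0) 2,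
    fderiv ℝ Φ ζ (e3 0) 1 - fderiv ℝ Φ ζ (e3 1) 0]

/-- `g` is a weak gradient of `u` on the open set `U ⊆ ℝ²`. -/
def HasWeakGradOn (U : Set E2) (u : E2 → 𝕜) (g : E2 → V2 𝕜) : Prop :=
  ∀ φ : E2 → ℝ, ContDiff ℝ ∞ φ → HasCompactSupport φ → tsupport φ ⊆ U → ∀ i : Fin 2,
    ∫ x in U, (fderiv ℝ φ x (e2 i) : 𝕜) * u x = -∫ x in U, (φ x : 𝕜) * g x i

/-- `u ∈ H¹(U)` with gradient `g`: both are square integrable on `U` and `g` is a weak gradient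
of `u`. -/
def IsH1WithGrad (U : Set E2) (u : E2 → 𝕜) (g : E2 → V2 𝕜) : Prop :=
  MemLp u 2 (volume.restrict U) ∧ MemLp g 2 (volume.restrict U) ∧ HasWeakGradOn U u g

/-! ### The two Sobolev spaces on the boundary -/

variable (𝕜)

/-- `L²(∂Ω)`. -/
abbrev L2 (Ω : Set E3) : Type _ := Lp 𝕜 2 (surfaceMeasure Ω)

/-- `L²(∂Ω)³`. -/
abbrev L2Vec (Ω : Set E3) : Type _ := Lp (V3 𝕜) 2 (surfaceMeasure Ω)

/-- The chart-defined space `H¹(∂Ω)`: the `f ∈ L²(∂Ω)` such that `f ∘ k⁻¹ ∈ H¹(U)` for every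
strong Lipschitz chart `k`. -/
def strongH1 (Ω : Set E3) : Set (L2 𝕜 Ω) :=
  {f | ∀ k : Chart Ω, ∃ g : E2 → V2 𝕜, IsH1WithGrad k.U (fun x => f (k.inv x)) g}

/-- The space `L²_τ(∂Ω)` of tangential square integrable fields. -/
def L2Tangential (Ω : Set E3) : Set (L2Vec 𝕜 Ω) :=
  {q | ∀ᵐ ζ ∂(surfaceMeasure Ω), dotV (normal Ω ζ) (q ζ) = 0}

variable {𝕜}

/-- `q ∈ L²(∂Ω)³` is the tangential gradient of `f` in the sense of charts: for every chart `k`,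
`q ∘ k⁻¹ = ((D k⁻¹)†)ᵀ ∇(f ∘ k⁻¹)` almost everywhere on `U`. -/
def IsTangGrad (Ω : Set E3) (f : L2 𝕜 Ω) (q : L2Vec 𝕜 Ω) : Prop :=
  ∀ k : Chart Ω, ∃ g : E2 → V2 𝕜, IsH1WithGrad k.U (fun x => f (k.inv x)) g ∧
    ∀ᵐ x ∂(volume.restrict k.U), ∀ i : Fin 3,
      q (k.inv x) i = ∑ j : Fin 2, ((k.pinv x)ᵀ i j : 𝕜) * g x j

/-- `q` is the tangential gradient of `f` in the weak sense: `q ∈ L²_τ(∂Ω)` and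
`⟨q, ν × Φ⟩ = ⟨f, ν · rot Φ⟩` in `L²(∂Ω)` for all smooth compactly supported fields `Φ`. -/
def IsWeakTangGrad (Ω : Set E3) (f : L2 𝕜 Ω) (q : L2Vec 𝕜 Ω) : Prop :=
  q ∈ L2Tangential 𝕜 Ω ∧
    ∀ Φ : E3 → V3 𝕜, ContDiff ℝ ∞ Φ → HasCompactSupport Φ →
      ∫ ζ, inner 𝕜 (q ζ) (crossV (normal Ω ζ) (Φ ζ)) ∂(surfaceMeasure Ω)
        = ∫ ζ, inner 𝕜 (f ζ) (dotV (normal Ω ζ) (rot Φ ζ)) ∂(surfaceMeasure Ω)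

variable (𝕜)

/-- The weakly defined space `H̃¹(∂Ω)`. -/
def weakH1 (Ω : Set E3) : Set (L2 𝕜 Ω) := {f | ∃ q : L2Vec 𝕜 Ω, IsWeakTangGrad Ω f q}

end Fields

end LipBdry

end

noncomputable section

namespace LipBdry

open Filter Topology

section Geometry

/-! ### Geometry of a graph patch -/

namespace GraphPatch

variable {Ω : Set E3} {p : E3} (P : GraphPatch Ω p)

/-! Both gradients are characterised by one identity with real scalar test functions. Putting `Φ = ψ
eᵢ` into the weak definition turns it into the vector identity `∫ ψ (ν × q) = -∫ f (ν × ∇ψ)`;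
conversely this identity for all `ψ` gives the one for every `Φ`, by splitting `Φ` into components
and real and imaginary parts (`hasTangGradOn_of_forall_field`, `integral_field_eq`). By a partition
of unity it is enough to take `ψ` supported in the cylinder of a chart.

In a chart write `F = k⁻¹`, `J = DF`, `u = f ∘ F` and `g = Jᵀ (q ∘ F)`. The area element times `ν`
is `±∂₀F × ∂₁F`, so the area element times `ν × q` is `±(g₀ ∂₁F - g₁ ∂₀F)`, and the identity
becomes, for each component `Fᵢ`, `∫ (ψ ∘ F)(∂₁Fᵢ g₀ - ∂₀Fᵢ g₁) = -∫ (∂₀(ψ ∘ F) ∂₁Fᵢ - ∂₁(ψ ∘ F)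
∂₀Fᵢ) u` (`Chart.tangGradTest_iff`).

If `g` is the weak gradient of `u`, this holds because a Jacobian is a divergence: the second
derivatives of `Fᵢ` cancel. As `F` is only Lipschitz, the computation is done for mollifications and
passed to the limit (`HasWeakGradOn.integral_jacobian`). Conversely, `F` is a graph, so `w l · ∂ⱼF`
is `1` for `l = j` and `0` otherwise; contracting the identity with the constant vectors `w l`
leaves exactly the definition of a weak gradient (`Chart.isH1WithGrad_of_hasTangGradOn`). Since `q ↦
Jᵀ q` is inverted on tangential vectors by `(J†)ᵀ`, the two notions agree for a given `q`.

Uniqueness holds because the identity determines `ν × q`, hence the tangential field `q`. It also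
makes the fields coming from different charts agree on overlaps, so for compact `∂Ω` finitely many
of them glue to a field in `L²`. Underneath lies the independence of the surface measure and of the
normal from the charts, by change of variables and by the position of `Ω` below each graph. -/

theorem orthonormal_frame : Orthonormal ℝ ![P.w 0, P.w 1, P.v] := by
  have h0 := P.orthonormal_w.1 0
  have h1 := P.orthonormal_w.1 1
  have h01 : inner ℝ (P.w 0) (P.w 1) = 0 := P.orthonormal_w.2 (by decide)
  have h0v := P.inner_w_v 0
  have h1v := P.inner_w_v 1
  have hv := P.norm_v
  constructor
  · intro i
    fin_cases i <;> simpa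
  · intro i j hij
    fin_cases i <;> fin_cases j <;> simp_all [real_inner_comm]

theorem expand (z : E3) :
    inner ℝ (P.w 0) z • P.w 0 + inner ℝ (P.w 1) z • P.w 1 + inner ℝ P.v z • P.v = z := by
  have hb : Orthonormal ℝ
      (basisOfOrthonormalOfCardEqFinrank P.orthonormal_frame (by simp)) := by
    simpa using P.orthonormal_frame
  have := (Module.Basis.toOrthonormalBasis _ hb).sum_repr' z
  simpa [Fin.sum_univ_three] using this

theorem sum_sq_w0 : P.w 0 0 ^ 2 + P.w 0 1 ^ 2 + P.w 0 2 ^ 2 = 1 := by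
  have h := P.orthonormal_w.1 0
  rw [EuclideanSpace.norm_eq, Real.sqrt_eq_one] at h
  simpa [Fin.sum_univ_three] using h

theorem sum_sq_w1 : P.w 1 0 ^ 2 + P.w 1 1 ^ 2 + P.w 1 2 ^ 2 = 1 := by
  have h := P.orthonormal_w.1 1
  rw [EuclideanSpace.norm_eq, Real.sqrt_eq_one] at h
  simpa [Fin.sum_univ_three] using h

theorem sum_sq_v : P.v 0 ^ 2 + P.v 1 ^ 2 + P.v 2 ^ 2 = 1 := by
  have h := P.norm_v
  rw [EuclideanSpace.norm_eq, Real.sqrt_eq_one] at h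
  simpa [Fin.sum_univ_three] using h

theorem sum_w0_w1 : P.w 0 0 * P.w 1 0 + P.w 0 1 * P.w 1 1 + P.w 0 2 * P.w 1 2 = 0 := by
  have h : inner ℝ (P.w 0) (P.w 1) = 0 := P.orthonormal_w.2 (by decide)
  simp [PiLp.inner_apply, Fin.sum_univ_three] at h
  linarith

theorem sum_w_v (i : Fin 2) : P.w i 0 * P.v 0 + P.w i 1 * P.v 1 + P.w i 2 * P.v 2 = 0 := by
  have h := P.inner_w_v i
  simp [PiLp.inner_apply, Fin.sum_univ_three] at h
  linarith

/-- The frame `w 0, w 1, v` is positively or negatively oriented. -/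
theorem exists_orientation : ∃ δ : ℝ, δ ^ 2 = 1 ∧
    crossProduct (P.w 0).ofLp (P.w 1).ofLp = δ • P.v.ofLp ∧
    crossProduct (P.w 1).ofLp P.v.ofLp = δ • (P.w 0).ofLp ∧
    crossProduct P.v.ofLp (P.w 0).ofLp = δ • (P.w 1).ofLp := by
  set M : Matrix (Fin 3) (Fin 3) ℝ := Matrix.of ![(P.w 0).ofLp, (P.w 1).ofLp, P.v.ofLp] with hM
  have h0 := P.sum_sq_w0
  have h1 := P.sum_sq_w1
  have hv := P.sum_sq_v
  have h01 := P.sum_w0_w1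
  have h0v := P.sum_w_v 0
  have h1v := P.sum_w_v 1
  have hMM : M * Mᵀ = 1 := by
    ext i j
    fin_cases i <;> fin_cases j <;>
      simp [hM, Matrix.mul_apply, Fin.sum_univ_three] <;> linarith
  have hdet : M.det ^ 2 = 1 := by
    have := congrArg Matrix.det hMM
    rw [Matrix.det_mul, Matrix.det_transpose, Matrix.det_one] at this
    rw [sq]; exact this
  -- The columns of the adjugate are the cross products of pairs of rows of `M`, so for an
  -- orthogonal matrix this single identity contains all three cross product formulas.
  have hadj : M.adjugate = M.det • Mᵀ := by
    calc M.adjugate = M.adjugate * (M * Mᵀ) := by rw [hMM, mul_one]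
      _ = M.det • Mᵀ := by
        rw [← Matrix.mul_assoc, Matrix.adjugate_mul, Matrix.smul_mul, Matrix.one_mul]
  refine ⟨M.det, hdet, ?_, ?_, ?_⟩
  · ext i
    have := congrFun (congrFun hadj i) 2
    fin_cases i <;>
      simp [hM, Matrix.adjugate_fin_three, crossProduct] at this ⊢ <;>
      linarith
  · ext i
    have := congrFun (congrFun hadj i) 0
    fin_cases i <;>
      simp [hM, Matrix.adjugate_fin_three, crossProduct] at this ⊢ <;>
      linarith
  · ext i
    have := congrFun (congrFun hadj i) 1
    fin_cases i <;>
      simp [hM, Matrix.adjugate_fin_three, crossProduct] at this ⊢ <;>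
      linarith

end GraphPatch

/-! ### Charts as traces of open cylinders, and their Lipschitz bounds. -/

namespace Chart

variable {Ω : Set E3} (k : Chart Ω)

/-- The open cylinder above and below the parameter domain of a chart. -/
def cyl : Set E3 :=
  {z | k.coord z ∈ k.U ∧ inner ℝ k.patch.v (z - k.p) ∈ Ioo (-k.patch.h) k.patch.h}

theorem coord_add (x : E2) (s : ℝ) :
    k.coord (k.p + x 0 • k.patch.w 0 + x 1 • k.patch.w 1 + s • k.patch.v) = x := by
  have h0 := k.patch.orthonormal_w.1 0
  have h1 := k.patch.orthonormal_w.1 1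
  have h01 : inner ℝ (k.patch.w 0) (k.patch.w 1) = 0 := k.patch.orthonormal_w.2 (by decide)
  have h10 : inner ℝ (k.patch.w 1) (k.patch.w 0) = 0 := k.patch.orthonormal_w.2 (by decide)
  have h0v := k.patch.inner_w_v 0
  have h1v := k.patch.inner_w_v 1
  have e : k.p + x 0 • k.patch.w 0 + x 1 • k.patch.w 1 + s • k.patch.v - k.p
      = x 0 • k.patch.w 0 + x 1 • k.patch.w 1 + s • k.patch.v := by abel
  ext i
  fin_cases i <;> simp [coord, inner_add_right, inner_smul_right, *]

theorem inner_v_add (x : E2) (s : ℝ) :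
    inner ℝ k.patch.v (k.p + x 0 • k.patch.w 0 + x 1 • k.patch.w 1 + s • k.patch.v - k.p) = s := by
  have h0v := k.patch.inner_w_v 0
  have h1v := k.patch.inner_w_v 1
  have hv := k.patch.norm_v
  have e : k.p + x 0 • k.patch.w 0 + x 1 • k.patch.w 1 + s • k.patch.v - k.p
      = x 0 • k.patch.w 0 + x 1 • k.patch.w 1 + s • k.patch.v := by abel
  rw [real_inner_comm] at h0v h1v
  simp [inner_add_right, inner_smul_right, *]

theorem expand_coord (z : E3) :
    k.p + k.coord z 0 • k.patch.w 0 + k.coord z 1 • k.patch.w 1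
      + inner ℝ k.patch.v (z - k.p) • k.patch.v = z := by
  have := k.patch.expand (z - k.p)
  simp only [coord, PiLp.toLp_apply, Matrix.cons_val_zero, Matrix.cons_val_one]
  rw [add_assoc, add_assoc, ← add_assoc (_ • _), this]
  abel

@[simp] theorem coord_inv (x : E2) : k.coord (k.inv x) = x := k.coord_add x _

@[simp] theorem inner_v_inv (x : E2) : inner ℝ k.patch.v (k.inv x - k.p) = k.patch.a x :=
  k.inner_v_add x _

theorem contDiff_coord : ContDiff ℝ ∞ k.coord := by
  rw [contDiff_euclidean]
  intro i
  fin_cases i <;> simp [coord] <;>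
    exact contDiff_const.inner ℝ (contDiff_id.sub contDiff_const)

theorem continuous_coord : Continuous k.coord := k.contDiff_coord.continuous

theorem isOpen_cyl : IsOpen k.cyl :=
  (k.isOpen_U.preimage k.continuous_coord).inter
    (isOpen_Ioo.preimage (by fun_prop))

theorem abs_a_lt {x : E2} (hx : x ∈ k.U) : |k.patch.a x| < k.patch.h / 2 :=
  k.patch.abs_a_lt x (k.U_subset hx)

theorem a_mem {x : E2} (hx : x ∈ k.U) : k.patch.a x ∈ Ioo (-k.patch.h) k.patch.h := by
  have h1 := abs_lt.1 (k.abs_a_lt hx)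
  have h2 := k.patch.h_pos
  constructor <;> linarith [h1.1, h1.2]

theorem inv_mem_cyl {x : E2} : k.inv x ∈ k.cyl ↔ x ∈ k.U := by
  constructor
  · intro h
    simpa using h.1
  · intro h
    exact ⟨by simpa using h, by simpa using k.a_mem h⟩

theorem mem_patchCyl {z : E3} (hz : z ∈ k.cyl) :
    z ∈ {z | ∃ x ∈ Metric.ball (0 : E2) k.patch.ε, ∃ s ∈ Ioo (-k.patch.h) k.patch.h,
        z = k.p + x 0 • k.patch.w 0 + x 1 • k.patch.w 1 + s • k.patch.v} :=
  ⟨k.coord z, k.U_subset hz.1, _, hz.2, (k.expand_coord z).symm⟩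

theorem inv_mem_frontier {x : E2} (hx : x ∈ k.U) : k.inv x ∈ frontier Ω := by
  have : k.inv x ∈ {z | ∃ x ∈ Metric.ball (0 : E2) k.patch.ε,
    z = k.p + x 0 • k.patch.w 0 + x 1 • k.patch.w 1 + k.patch.a x • k.patch.v} :=
    ⟨x, k.U_subset hx, rfl⟩
  rw [← k.patch.frontier_inter] at this
  exact this.1

/-- Being the trace of an open set of the ambient space makes `Γ` measurable, gives open covers of
`∂Ω`, and lets test functions on `ℝ³` be localised to a chart. -/
theorem dom_eq : k.dom = frontier Ω ∩ k.cyl := by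
  ext z
  constructor
  · rintro ⟨x, hx, rfl⟩
    exact ⟨k.inv_mem_frontier hx, k.inv_mem_cyl.2 hx⟩
  · rintro ⟨hz, hc⟩
    have := (Set.ext_iff.1 k.patch.frontier_inter z).1 ⟨hz, k.mem_patchCyl hc⟩
    obtain ⟨x, hx, h⟩ := this
    have hx' : k.coord z = x := by rw [h]; exact k.coord_add x _
    refine ⟨x, hx' ▸ hc.1, h.symm⟩

theorem mem_domain_iff {z : E3} (hz : z ∈ k.cyl) :
    z ∈ Ω ↔ inner ℝ k.patch.v (z - k.p) < k.patch.a (k.coord z) := by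
  have key := Set.ext_iff.1 k.patch.domain_inter z
  constructor
  · intro h
    obtain ⟨x, hx, s, hs, e⟩ := key.1 ⟨h, k.mem_patchCyl hz⟩
    rw [e, k.coord_add, k.inner_v_add]
    exact hs.2
  · intro h
    exact (key.2 ⟨k.coord z, k.U_subset hz.1, _, ⟨hz.2.1, h⟩, (k.expand_coord z).symm⟩).1

theorem inv_coord {z : E3} (hz : z ∈ k.dom) : k.inv (k.coord z) = z := by
  obtain ⟨x, -, rfl⟩ := hz
  simp

theorem coord_mem {z : E3} (hz : z ∈ k.dom) : k.coord z ∈ k.U := by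
  obtain ⟨x, hx, rfl⟩ := hz
  simpa using hx

theorem inv_mem_dom {x : E2} : k.inv x ∈ k.dom ↔ x ∈ k.U := by
  constructor
  · intro h
    simpa using k.coord_mem h
  · exact fun h => ⟨x, h, rfl⟩

theorem dom_subset_frontier : k.dom ⊆ frontier Ω := k.dom_eq ▸ inter_subset_left

theorem dom_subset_cyl : k.dom ⊆ k.cyl := k.dom_eq ▸ inter_subset_right

theorem measurableSet_dom : MeasurableSet k.dom := by
  rw [k.dom_eq]
  exact isClosed_frontier.measurableSet.inter k.isOpen_cyl.measurableSet

theorem injective_inv : Function.Injective k.inv := fun x y h => by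
  simpa using congrArg k.coord h

/-- Nothing is known about `a` outside the ball, not even measurability. Global arguments such as
mollification use a Lipschitz function that agrees with it on `U`. -/
theorem exists_lipschitzWith_ext :
    ∃ (K : ℝ≥0) (A : E2 → ℝ), LipschitzWith K A ∧ EqOn k.patch.a A k.U := by
  obtain ⟨K, hK⟩ := k.patch.lipschitz_a
  obtain ⟨A, hA, hE⟩ := (hK.mono k.U_subset).extend_real
  exact ⟨K, A, hA, hE⟩

theorem exists_lipschitzOnWith_inv : ∃ K : ℝ≥0, LipschitzOnWith K k.inv k.U := by
  obtain ⟨K, hK⟩ := k.patch.lipschitz_a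
  have hK := hK.mono k.U_subset
  refine ⟨1 + 1 + K, LipschitzOnWith.of_dist_le_mul fun x hx y hy => ?_⟩
  have h0 : ‖k.patch.w 0‖ = 1 := k.patch.orthonormal_w.1 0
  have h1 : ‖k.patch.w 1‖ = 1 := k.patch.orthonormal_w.1 1
  have hv := k.patch.norm_v
  have e : k.inv x - k.inv y = (x 0 - y 0) • k.patch.w 0 + (x 1 - y 1) • k.patch.w 1
      + (k.patch.a x - k.patch.a y) • k.patch.v := by
    simp only [inv, sub_smul]; abel
  have b (i : Fin 2) : |x i - y i| ≤ dist x y := by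
    rw [dist_eq_norm]
    exact PiLp.norm_apply_le (x - y) i
  have ba := hK.dist_le_mul x hx y hy
  rw [dist_eq_norm, e]
  refine (norm_add₃_le).trans ?_
  rw [norm_smul, norm_smul, norm_smul, h0, h1, hv, Real.norm_eq_abs, Real.norm_eq_abs]
  rw [Real.dist_eq] at ba
  push_cast
  rw [Real.norm_eq_abs]
  linarith [b 0, b 1]

theorem continuousOn_inv : ContinuousOn k.inv k.U := by
  obtain ⟨K, hK⟩ := k.exists_lipschitzOnWith_inv
  exact hK.continuousOn

theorem exists_lipschitzWith_coord : ∃ K : ℝ≥0, LipschitzWith K k.coord := by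
  refine ⟨1 + 1, LipschitzWith.of_dist_le_mul fun z y => ?_⟩
  have h0 : ‖k.patch.w 0‖ = 1 := k.patch.orthonormal_w.1 0
  have h1 : ‖k.patch.w 1‖ = 1 := k.patch.orthonormal_w.1 1
  have e (i : Fin 2) : |inner ℝ (k.patch.w i) (z - y)| ≤ ‖z - y‖ := by
    have := abs_real_inner_le_norm (k.patch.w i) (z - y)
    rwa [k.patch.orthonormal_w.1 i, one_mul] at this
  have e' (i : Fin 2) : inner ℝ (k.patch.w i) (z - k.p) - inner ℝ (k.patch.w i) (y - k.p)
      = inner ℝ (k.patch.w i) (z - y) := by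
    rw [← inner_sub_right]; congr 1; abel
  rw [EuclideanSpace.dist_eq, dist_eq_norm z y]
  refine Real.sqrt_le_iff.2 ⟨by positivity, ?_⟩
  have b0 := sq_le_sq' (by linarith [neg_le_of_abs_le (e 0)]) (le_of_abs_le (e 0))
  have b1 := sq_le_sq' (by linarith [neg_le_of_abs_le (e 1)]) (le_of_abs_le (e 1))
  simp [coord, Real.dist_eq, e', Fin.sum_univ_two]
  nlinarith [norm_nonneg (z - y)]

/-- Almost every parameter is a point of differentiability of the graph function. -/
theorem ae_differentiableAt : ∀ᵐ x ∂(volume.restrict k.U), DifferentiableAt ℝ k.patch.a x := by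
  obtain ⟨K, hK⟩ := k.patch.lipschitz_a
  have h := (hK.mono k.U_subset).ae_differentiableWithinAt (μ := volume)
    k.isOpen_U.measurableSet
  filter_upwards [h, ae_restrict_mem k.isOpen_U.measurableSet] with x hx hU
  exact hx.differentiableAt (k.isOpen_U.mem_nhds hU)

end Chart

/-! ### Covering the boundary by countably many charts. -/

theorem exists_chart {Ω : Set E3} (hΩ : IsStrongLipschitzDomain Ω) {p : E3}
    (hp : p ∈ frontier Ω) : ∃ k : Chart Ω, p ∈ k.dom := by
  obtain ⟨P⟩ := hΩ.2 p hp
  let k : Chart Ω := ⟨p, hp, P, Metric.ball 0 P.ε, Metric.isOpen_ball,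
    ⟨0, Metric.mem_ball_self P.ε_pos⟩, subset_rfl⟩
  refine ⟨k, k.dom_eq ▸ ⟨hp, ?_, ?_⟩⟩
  · have : k.coord p = 0 := by
      ext i
      fin_cases i <;> simp [Chart.coord, k]
    rw [this]
    exact Metric.mem_ball_self P.ε_pos
  · have := P.h_pos
    simp [k, this]

/-- Lindelöf for the open cylinders. The boundary has to be nonempty because a chart contains a
boundary point, so otherwise there is no sequence of charts at all. -/
theorem exists_isAtlas {Ω : Set E3} (hΩ : IsStrongLipschitzDomain Ω)
    (hne : (frontier Ω).Nonempty) : ∃ c : ℕ → Chart Ω, IsAtlas c := by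
  have : ∀ p : frontier Ω, ∃ k : Chart Ω, (p : E3) ∈ k.dom := fun p => exists_chart hΩ p.2
  choose κ hκ using this
  obtain ⟨T, hT, hcov⟩ := TopologicalSpace.isOpen_iUnion_countable
    (fun p : frontier Ω => (κ p).cyl) (fun p => (κ p).isOpen_cyl)
  have hsub : frontier Ω ⊆ ⋃ p ∈ T, (κ p).dom := by
    intro z hz
    have : z ∈ ⋃ p ∈ T, (κ p).cyl := by
      rw [hcov]
      exact mem_iUnion.2 ⟨⟨z, hz⟩, (κ _).dom_subset_cyl (hκ ⟨z, hz⟩)⟩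
    obtain ⟨p, hp, hzp⟩ := mem_iUnion₂.1 this
    exact mem_iUnion₂.2 ⟨p, hp, (κ p).dom_eq ▸ ⟨hz, hzp⟩⟩
  have hTne : T.Nonempty := by
    obtain ⟨z, hz⟩ := hne
    obtain ⟨p, hp, -⟩ := mem_iUnion₂.1 (hsub hz)
    exact ⟨p, hp⟩
  obtain ⟨e, he⟩ := hT.exists_eq_range hTne
  refine ⟨fun n => κ (e n), fun z hz => ?_⟩
  obtain ⟨p, hp, hzp⟩ := mem_iUnion₂.1 (hsub hz)
  rw [he] at hp
  obtain ⟨n, rfl⟩ := hp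
  exact mem_iUnion.2 ⟨n, hzp⟩

end Geometry

section Coordinates

namespace Chart

variable {Ω : Set E3} (k : Chart Ω)

/-! ### The Jacobian, its pseudoinverse, and the normal in coordinates -/

/-- The partial derivatives of the graph function. -/
def slope (x : E2) (j : Fin 2) : ℝ := fderiv ℝ k.patch.a x (e2 j)

/-- The squared area element in terms of the graph function. -/
def gramDet (x : E2) : ℝ := 1 + k.slope x 0 ^ 2 + k.slope x 1 ^ 2

/-- The area element of a chart. -/
def area (x : E2) : ℝ := Real.sqrt ((k.jac x)ᵀ * k.jac x).det

theorem one_le_gramDet (x : E2) : 1 ≤ k.gramDet x := by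
  unfold gramDet; nlinarith [sq_nonneg (k.slope x 0), sq_nonneg (k.slope x 1)]

theorem gramDet_pos (x : E2) : 0 < k.gramDet x := by linarith [k.one_le_gramDet x]

theorem hasFDerivAt_inv {x : E2} (h : DifferentiableAt ℝ k.patch.a x) :
    HasFDerivAt k.inv ((EuclideanSpace.proj 0 : E2 →L[ℝ] ℝ).smulRight (k.patch.w 0)
      + (EuclideanSpace.proj 1 : E2 →L[ℝ] ℝ).smulRight (k.patch.w 1)
      + (fderiv ℝ k.patch.a x).smulRight k.patch.v) x := by
  have h0 : HasFDerivAt (fun x : E2 => x 0 • k.patch.w 0)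
      ((EuclideanSpace.proj 0 : E2 →L[ℝ] ℝ).smulRight (k.patch.w 0)) x :=
    ((EuclideanSpace.proj 0 : E2 →L[ℝ] ℝ).hasFDerivAt (x := x)).smul_const (k.patch.w 0)
  have h1 : HasFDerivAt (fun x : E2 => x 1 • k.patch.w 1)
      ((EuclideanSpace.proj 1 : E2 →L[ℝ] ℝ).smulRight (k.patch.w 1)) x :=
    ((EuclideanSpace.proj 1 : E2 →L[ℝ] ℝ).hasFDerivAt (x := x)).smul_const (k.patch.w 1)
  have h2 := h.hasFDerivAt.smul_const k.patch.v
  exact ((h0.const_add k.p).add h1).add h2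

theorem fderiv_inv_apply {x : E2} (h : DifferentiableAt ℝ k.patch.a x) (j : Fin 2) :
    fderiv ℝ k.inv x (e2 j) = k.patch.w j + k.slope x j • k.patch.v := by
  rw [(k.hasFDerivAt_inv h).fderiv]
  fin_cases j <;> simp [e2, slope]

theorem jac_apply {x : E2} (h : DifferentiableAt ℝ k.patch.a x) (i : Fin 3) (j : Fin 2) :
    k.jac x i j = k.patch.w j i + k.slope x j * k.patch.v i := by
  simp [jac, k.fderiv_inv_apply h]

theorem gram_eq {x : E2} (h : DifferentiableAt ℝ k.patch.a x) :
    (k.jac x)ᵀ * k.jac x = !![1 + k.slope x 0 ^ 2, k.slope x 0 * k.slope x 1;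
      k.slope x 0 * k.slope x 1, 1 + k.slope x 1 ^ 2] := by
  have h0 := k.patch.sum_sq_w0
  have h1 := k.patch.sum_sq_w1
  have hv := k.patch.sum_sq_v
  have h01 := k.patch.sum_w0_w1
  have h0v := k.patch.sum_w_v 0
  have h1v := k.patch.sum_w_v 1
  ext i j
  fin_cases i <;> fin_cases j <;>
    simp [Matrix.mul_apply, Fin.sum_univ_three, k.jac_apply h]
  · linear_combination h0 + k.slope x 0 ^ 2 * hv + 2 * k.slope x 0 * h0v
  · linear_combination h01 + k.slope x 0 * k.slope x 1 * hv + k.slope x 1 * h0v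
      + k.slope x 0 * h1v
  · linear_combination h01 + k.slope x 0 * k.slope x 1 * hv + k.slope x 1 * h0v
      + k.slope x 0 * h1v
  · linear_combination h1 + k.slope x 1 ^ 2 * hv + 2 * k.slope x 1 * h1v

theorem det_gram {x : E2} (h : DifferentiableAt ℝ k.patch.a x) :
    ((k.jac x)ᵀ * k.jac x).det = k.gramDet x := by
  rw [k.gram_eq h, Matrix.det_fin_two_of, gramDet]
  ring

theorem area_eq {x : E2} (h : DifferentiableAt ℝ k.patch.a x) :
    k.area x = Real.sqrt (k.gramDet x) := by
  rw [area, k.det_gram h]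

theorem one_le_area {x : E2} (h : DifferentiableAt ℝ k.patch.a x) : 1 ≤ k.area x := by
  rw [k.area_eq h]
  exact Real.one_le_sqrt.2 (k.one_le_gramDet x)

theorem normal_eq (x : E2) : k.normal x = (Real.sqrt (k.gramDet x))⁻¹ •
    (-(k.slope x 0) • k.patch.w 0 - k.slope x 1 • k.patch.w 1 + k.patch.v) := rfl

theorem normal_apply (x : E2) (i : Fin 3) : k.normal x i = (Real.sqrt (k.gramDet x))⁻¹ *
    (-(k.slope x 0 * k.patch.w 0 i) - k.slope x 1 * k.patch.w 1 i + k.patch.v i) := by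
  simp [normal_eq]
  ring

theorem sum_sq_normal (x : E2) :
    k.normal x 0 ^ 2 + k.normal x 1 ^ 2 + k.normal x 2 ^ 2 = 1 := by
  have h0 := k.patch.sum_sq_w0
  have h1 := k.patch.sum_sq_w1
  have hv := k.patch.sum_sq_v
  have h01 := k.patch.sum_w0_w1
  have h0v := k.patch.sum_w_v 0
  have h1v := k.patch.sum_w_v 1
  have hc := k.gramDet_pos x
  have hs : (Real.sqrt (k.gramDet x))⁻¹ ^ 2 * k.gramDet x = 1 := by
    rw [inv_pow, Real.sq_sqrt hc.le, inv_mul_cancel₀ hc.ne']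
  simp only [normal_apply]
  set r := (Real.sqrt (k.gramDet x))⁻¹
  rw [gramDet] at hs
  linear_combination hs + r ^ 2 * (k.slope x 0 ^ 2 * h0 + k.slope x 1 ^ 2 * h1 + hv
    + 2 * k.slope x 0 * k.slope x 1 * h01 - 2 * k.slope x 0 * h0v - 2 * k.slope x 1 * h1v)

theorem area_mul_normal {x : E2} (h : DifferentiableAt ℝ k.patch.a x) (i : Fin 3) :
    k.area x * k.normal x i
      = -(k.slope x 0 * k.patch.w 0 i) - k.slope x 1 * k.patch.w 1 i + k.patch.v i := by
  have hc : Real.sqrt (k.gramDet x) ≠ 0 := (Real.sqrt_pos.2 (k.gramDet_pos x)).ne'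
  rw [k.area_eq h, normal_apply, mul_inv_cancel_left₀ hc]

/-- The area element times the unit normal is, up to orientation, the cross product of the
columns of the Jacobian. -/
theorem exists_orientation : ∃ δ : ℝ, δ ≠ 0 ∧ ∀ x, DifferentiableAt ℝ k.patch.a x →
    k.area x * k.normal x 0 = δ * (k.jac x 1 0 * k.jac x 2 1 - k.jac x 2 0 * k.jac x 1 1) ∧
    k.area x * k.normal x 1 = δ * (k.jac x 2 0 * k.jac x 0 1 - k.jac x 0 0 * k.jac x 2 1) ∧
    k.area x * k.normal x 2 = δ * (k.jac x 0 0 * k.jac x 1 1 - k.jac x 1 0 * k.jac x 0 1) := by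
  obtain ⟨δ, hδ, h01, h1v, hv0⟩ := k.patch.exists_orientation
  refine ⟨δ, fun h0 => by simp [h0] at hδ, fun x h => ?_⟩
  simp only [k.area_mul_normal h, k.jac_apply h]
  refine ⟨?_, ?_, ?_⟩
  · have e1 := congrFun h01 0
    have e2 := congrFun h1v 0
    have e3 := congrFun hv0 0
    simp [crossProduct] at e1 e2 e3
    linear_combination (-δ) * e1 + k.slope x 0 * δ * e2 + k.slope x 1 * δ * e3
      + (-k.patch.v 0 + k.slope x 0 * k.patch.w 0 0 + k.slope x 1 * k.patch.w 1 0) * hδ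
  · have e1 := congrFun h01 1
    have e2 := congrFun h1v 1
    have e3 := congrFun hv0 1
    simp [crossProduct] at e1 e2 e3
    linear_combination (-δ) * e1 + k.slope x 0 * δ * e2 + k.slope x 1 * δ * e3
      + (-k.patch.v 1 + k.slope x 0 * k.patch.w 0 1 + k.slope x 1 * k.patch.w 1 1) * hδ
  · have e1 := congrFun h01 2
    have e2 := congrFun h1v 2
    have e3 := congrFun hv0 2
    simp [crossProduct] at e1 e2 e3
    linear_combination (-δ) * e1 + k.slope x 0 * δ * e2 + k.slope x 1 * δ * e3
      + (-k.patch.v 2 + k.slope x 0 * k.patch.w 0 2 + k.slope x 1 * k.patch.w 1 2) * hδ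

theorem sum_normal_jac {x : E2} (h : DifferentiableAt ℝ k.patch.a x) (j : Fin 2) :
    k.normal x 0 * k.jac x 0 j + k.normal x 1 * k.jac x 1 j + k.normal x 2 * k.jac x 2 j = 0 := by
  have h0 := k.patch.sum_sq_w0
  have h1 := k.patch.sum_sq_w1
  have hv := k.patch.sum_sq_v
  have h01 := k.patch.sum_w0_w1
  have h0v := k.patch.sum_w_v 0
  have h1v := k.patch.sum_w_v 1
  simp only [normal_apply, k.jac_apply h]
  set r := (Real.sqrt (k.gramDet x))⁻¹
  fin_cases j <;> simp only [Fin.zero_eta, Fin.mk_one]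
  · linear_combination r * (-k.slope x 0 * h0 + h0v - k.slope x 1 * h01
      - k.slope x 0 * k.slope x 1 * h1v - k.slope x 0 ^ 2 * h0v + k.slope x 0 * hv)
  · linear_combination r * (-k.slope x 1 * h1 + h1v - k.slope x 0 * h01
      - k.slope x 0 * k.slope x 1 * h0v - k.slope x 1 ^ 2 * h1v + k.slope x 1 * hv)

theorem isUnit_det_gram {x : E2} (h : DifferentiableAt ℝ k.patch.a x) :
    IsUnit ((k.jac x)ᵀ * k.jac x).det := by
  rw [k.det_gram h]
  exact (k.gramDet_pos x).ne'.isUnit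

theorem pinv_mul_jac {x : E2} (h : DifferentiableAt ℝ k.patch.a x) :
    k.pinv x * k.jac x = 1 := by
  rw [pinv, Matrix.mul_assoc, Matrix.nonsing_inv_mul _ (k.isUnit_det_gram h)]

theorem pinv_transpose (x : E2) :
    (k.pinv x)ᵀ = k.jac x * ((k.jac x)ᵀ * k.jac x)⁻¹ := by
  rw [pinv, Matrix.transpose_mul, Matrix.transpose_transpose, Matrix.transpose_nonsing_inv,
    Matrix.transpose_mul, Matrix.transpose_transpose]

theorem pinv_mul_pinv_transpose {x : E2} (h : DifferentiableAt ℝ k.patch.a x) :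
    k.pinv x * (k.pinv x)ᵀ = ((k.jac x)ᵀ * k.jac x)⁻¹ := by
  rw [pinv_transpose, ← Matrix.mul_assoc, k.pinv_mul_jac h, Matrix.one_mul]

/-- The squared norms of the columns of `(J†)ᵀ` are the diagonal entries of `(JᵀJ)⁻¹`, and `JᵀJ = 1
+ ∇a ∇aᵀ` is at least the identity. Hence passing from `g` to `(J†)ᵀ g` preserves square
integrability. -/
theorem abs_pinv_transpose_le {x : E2} (h : DifferentiableAt ℝ k.patch.a x) (i : Fin 3)
    (j : Fin 2) : |(k.pinv x)ᵀ i j| ≤ 1 := by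
  have hc := k.gramDet_pos x
  have key : ∑ i, (k.pinv x)ᵀ i j ^ 2 ≤ 1 := by
    have e := congrFun (congrFun (k.pinv_mul_pinv_transpose h) j) j
    rw [Matrix.inv_def, k.det_gram h, k.gram_eq h, Ring.inverse_eq_inv'] at e
    simp only [Matrix.mul_apply, Matrix.transpose_apply, ← sq] at e
    simp only [Matrix.transpose_apply]
    rw [e]
    fin_cases j <;> simp [Matrix.adjugate_fin_two] <;> rw [inv_mul_le_iff₀ hc, gramDet] <;>
      nlinarith [sq_nonneg (k.slope x 0), sq_nonneg (k.slope x 1)]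
  rw [abs_le_one_iff_mul_self_le_one, ← sq]
  exact (Finset.single_le_sum (fun i _ => sq_nonneg ((k.pinv x)ᵀ i j)) (Finset.mem_univ i)).trans key

theorem normal_pinv {x : E2} (h : DifferentiableAt ℝ k.patch.a x) (j : Fin 2) :
    k.normal x 0 * (k.pinv x)ᵀ 0 j + k.normal x 1 * (k.pinv x)ᵀ 1 j
      + k.normal x 2 * (k.pinv x)ᵀ 2 j = 0 := by
  have h0 := k.sum_normal_jac h 0
  have h1 := k.sum_normal_jac h 1
  rw [pinv_transpose]
  simp only [Matrix.mul_apply, Fin.sum_univ_two]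
  set G := ((k.jac x)ᵀ * k.jac x)⁻¹
  linear_combination G 0 j * h0 + G 1 j * h1

/-! ### Tangential vectors and their covariant components. -/

variable {𝕜 : Type*} [RCLike 𝕜]

/-- The covariant components `Jᵀ q` of a vector. -/
def cov (x : E2) (q : V3 𝕜) : V2 𝕜 :=
  WithLp.toLp 2 fun j => ∑ i, (k.jac x i j : 𝕜) * q i

/-- The vector `(J†)ᵀ g` with covariant components `g`. -/
def vec (x : E2) (g : V2 𝕜) : V3 𝕜 :=
  WithLp.toLp 2 fun i => ∑ j, ((k.pinv x)ᵀ i j : 𝕜) * g j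

theorem cov_vec {x : E2} (h : DifferentiableAt ℝ k.patch.a x) (g : V2 𝕜) :
    k.cov x (k.vec x g) = g := by
  ext l
  have hp := k.pinv_mul_jac h
  have e (j : Fin 2) : ∑ i, (k.jac x i l : 𝕜) * ((k.pinv x)ᵀ i j : 𝕜) = if j = l then 1 else 0 := by
    have := congrFun (congrFun hp j) l
    rw [Matrix.mul_apply, Matrix.one_apply] at this
    have := congrArg (RCLike.ofReal (K := 𝕜)) this
    push_cast at this
    rw [apply_ite (RCLike.ofReal (K := 𝕜))] at this
    simpa [mul_comm] using this
  have e0 := e 0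
  have e1 := e 1
  simp only [cov, vec, Fin.sum_univ_three, Fin.sum_univ_two] at *
  fin_cases l <;> simp at e0 e1 ⊢ <;> linear_combination g 0 * e0 + g 1 * e1

theorem dotV_vec {x : E2} (h : DifferentiableAt ℝ k.patch.a x) (g : V2 𝕜) :
    dotV (k.normal x) (k.vec x g) = 0 := by
  have e (j : Fin 2) := congrArg (RCLike.ofReal (K := 𝕜)) (k.normal_pinv h j)
  push_cast at e
  simp only [dotV, vec, Fin.sum_univ_three, Fin.sum_univ_two]
  linear_combination g 0 * e 0 + g 1 * e 1

/-- Vanishing of `ν · q` expresses `v · q` through the numbers `c l = w l · q`, which gives `q = J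
c`. On the column space of `J` the map `(J†)ᵀ Jᵀ` is the identity because `(J†)ᵀ JᵀJ = J`. -/
theorem vec_cov {x : E2} (h : DifferentiableAt ℝ k.patch.a x) (q : V3 𝕜)
    (hq : dotV (k.normal x) q = 0) : k.vec x (k.cov x q) = q := by
  have hrep : ∃ c : Fin 2 → 𝕜, ∀ i, q i = ∑ l, (k.jac x i l : 𝕜) * c l := by
    refine ⟨fun l => ∑ i, (k.patch.w l i : 𝕜) * q i, fun i => ?_⟩
    have hexp (m : Fin 3) : ((k.patch.w 0 m * k.patch.w 0 i + k.patch.w 1 m * k.patch.w 1 i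
        + k.patch.v m * k.patch.v i : ℝ) : 𝕜) = if m = i then 1 else 0 := by
      have := congrArg (fun z : E3 => z i) (k.patch.expand (EuclideanSpace.single m 1))
      simp [PiLp.inner_apply, eq_comm] at this
      rw [← this]
      by_cases hmi : m = i
      · simp [hmi]
      · simp [hmi, Ne.symm hmi]
    have hn : ((Real.sqrt (k.gramDet x) : ℝ) : 𝕜) * dotV (k.normal x) q = 0 := by simp [hq]
    have hr : ((Real.sqrt (k.gramDet x) : ℝ) : 𝕜) ≠ 0 := by
      simpa using (Real.sqrt_pos.2 (k.gramDet_pos x)).ne'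
    simp only [dotV, Fin.sum_univ_three, normal_apply] at hn
    push_cast at hn
    field_simp at hn
    have m0 := hexp 0
    have m1 := hexp 1
    have m2 := hexp 2
    push_cast at m0 m1 m2
    have hqi : q i = (if 0 = i then 1 else 0) * q 0 + (if 1 = i then 1 else 0) * q 1
        + (if 2 = i then 1 else 0) * q 2 := by
      fin_cases i <;> simp
    rw [hqi, ← m0, ← m1, ← m2]
    simp only [Fin.sum_univ_two, Fin.sum_univ_three, k.jac_apply h]
    push_cast
    linear_combination (k.patch.v i : 𝕜) * hn
  obtain ⟨c, hc⟩ := hrep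
  have hm : (k.pinv x)ᵀ * ((k.jac x)ᵀ * k.jac x) = k.jac x := by
    rw [pinv_transpose, Matrix.mul_assoc, Matrix.nonsing_inv_mul _ (k.isUnit_det_gram h),
      Matrix.mul_one]
  ext i
  have e (l : Fin 2) := congrArg (RCLike.ofReal (K := 𝕜)) (congrFun (congrFun hm i) l)
  simp only [Matrix.mul_apply, Fin.sum_univ_two, Fin.sum_univ_three, Matrix.transpose_apply] at e
  push_cast at e
  have e0 := e 0
  have e1 := e 1
  simp only [vec, cov, Fin.sum_univ_two, Fin.sum_univ_three, hc, Matrix.transpose_apply]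
  linear_combination c 0 * e0 + c 1 * e1

/-- The cross product of the normal with a vector in terms of covariant components. -/
theorem exists_area_mul_crossV : ∃ δ : ℝ, δ ≠ 0 ∧ ∀ x, DifferentiableAt ℝ k.patch.a x →
    ∀ (q : V3 𝕜) (i : Fin 3), (k.area x : 𝕜) * crossV (k.normal x) q i
      = (δ : 𝕜) * ((k.jac x i 1 : 𝕜) * k.cov x q 0 - (k.jac x i 0 : 𝕜) * k.cov x q 1) := by
  obtain ⟨δ, hδ, H⟩ := k.exists_orientation
  refine ⟨δ, hδ, fun x h q i => ?_⟩
  obtain ⟨h0, h1, h2⟩ := H x h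
  replace h0 := congrArg (RCLike.ofReal (K := 𝕜)) h0
  replace h1 := congrArg (RCLike.ofReal (K := 𝕜)) h1
  replace h2 := congrArg (RCLike.ofReal (K := 𝕜)) h2
  push_cast at h0 h1 h2
  -- What remains is `(b × c) × q = (b · q) c - (c · q) b` for the columns `b`, `c` of the Jacobian.
  fin_cases i <;> simp [crossV, crossProduct, cov, Fin.sum_univ_three]
  · linear_combination q 2 * h1 - q 1 * h2
  · linear_combination q 0 * h2 - q 2 * h0
  · linear_combination q 1 * h0 - q 0 * h1

end Chart

end Coordinates

section ChartMeasure

/-! ### The surface measure of a chart -/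

/-- Two-dimensional Hausdorff measure and Lebesgue measure are multiples of each other by uniqueness
of Haar measure, and a Lipschitz map enlarges the former by at most a factor. The Lipschitz bound is
asked on `N` only, since transition maps are controlled only on a part of the plane. -/
theorem volume_image_eq_zero_of_lipschitzOnWith {f : E2 → E2} {K : ℝ≥0} {N : Set E2}
    (hf : LipschitzOnWith K f N) (hN : volume N = 0) : volume (f '' N) = 0 := by
  have hr : (Module.finrank ℝ E2 : ℝ) = 2 := by simp
  have hH : (Measure.hausdorffMeasure (Module.finrank ℝ E2 : ℝ) : Measure E2) N = 0 := by
    rw [Measure.isAddLeftInvariant_eq_smul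
      (Measure.hausdorffMeasure (Module.finrank ℝ E2 : ℝ) : Measure E2) volume]
    simp [hN]
  have himg : (Measure.hausdorffMeasure (Module.finrank ℝ E2 : ℝ) : Measure E2) (f '' N) = 0 := by
    have := hf.hausdorffMeasure_image_le (d := (Module.finrank ℝ E2 : ℝ)) (by positivity)
    rw [hH, mul_zero] at this
    exact le_antisymm this zero_le
  rw [Measure.isAddLeftInvariant_eq_smul volume
    (Measure.hausdorffMeasure (Module.finrank ℝ E2 : ℝ) : Measure E2)]
  simp only [Measure.smul_apply, himg, smul_zero]

namespace Chart

variable {Ω : Set E3} (k : Chart Ω)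

theorem exists_ext_inv : ∃ (K : ℝ≥0) (A : E2 → ℝ), LipschitzWith K A ∧ EqOn k.patch.a A k.U ∧
    EqOn k.inv (fun x => k.p + x 0 • k.patch.w 0 + x 1 • k.patch.w 1 + A x • k.patch.v) k.U := by
  obtain ⟨K, A, hA, hE⟩ := k.exists_lipschitzWith_ext
  exact ⟨K, A, hA, hE, fun x hx => by simp only [inv, hE hx]⟩

theorem exists_continuous_ext : ∃ F : E2 → E3, Continuous F ∧ EqOn k.inv F k.U := by
  obtain ⟨K, A, hA, -, hF⟩ := k.exists_ext_inv
  refine ⟨_, ?_, hF⟩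
  have := hA.continuous
  fun_prop

theorem measurableSet_inter_preimage {A : Set E3} (hA : MeasurableSet A) :
    MeasurableSet (k.U ∩ k.inv ⁻¹' A) := by
  obtain ⟨F, hF, hE⟩ := k.exists_continuous_ext
  have : k.U ∩ k.inv ⁻¹' A = k.U ∩ F ⁻¹' A := by
    ext x
    exact and_congr_right fun hx => by rw [mem_preimage, mem_preimage, hE hx]
  rw [this]
  exact k.isOpen_U.measurableSet.inter (hF.measurable hA)

theorem measurable_jac (i : Fin 3) (j : Fin 2) : Measurable fun x => k.jac x i j := by
  have h : Measurable fun x => fderiv ℝ k.inv x (e2 j) := measurable_fderiv_apply_const ℝ _ _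
  exact (measurable_pi_apply i).comp ((PiLp.continuous_ofLp 2 _).measurable.comp h)

theorem measurable_area : Measurable k.area := by
  have h := k.measurable_jac
  unfold area
  simp only [Matrix.det_fin_two, Matrix.mul_apply, Matrix.transpose_apply, Fin.sum_univ_three]
  fun_prop

theorem measurable_slope (j : Fin 2) : Measurable fun x => k.slope x j :=
  measurable_fderiv_apply_const ℝ _ _

theorem measurable_normal : Measurable k.normal := by
  have h := k.measurable_slope
  have : k.normal = fun x => (Real.sqrt (1 + k.slope x 0 ^ 2 + k.slope x 1 ^ 2))⁻¹ •
    (-(k.slope x 0) • k.patch.w 0 - k.slope x 1 • k.patch.w 1 + k.patch.v) := rfl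
  rw [this]
  fun_prop

theorem aemeasurable_inv {μ : Measure E2} (hμ : μ ≪ volume.restrict k.U) :
    AEMeasurable k.inv μ :=
  (k.continuousOn_inv.aemeasurable k.isOpen_U.measurableSet).mono_ac hμ

theorem measure_apply {A : Set E3} (hA : MeasurableSet A) :
    k.measure A = ∫⁻ x in k.U ∩ k.inv ⁻¹' A, ENNReal.ofReal (k.area x) := by
  rw [measure, Measure.map_apply_of_aemeasurable
    (k.aemeasurable_inv (withDensity_absolutelyContinuous _ _)) hA, withDensity_apply',
    Measure.restrict_restrict' k.isOpen_U.measurableSet, inter_comm]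
  rfl

theorem measure_compl_dom : k.measure k.domᶜ = 0 := by
  rw [k.measure_apply k.measurableSet_dom.compl]
  have : k.U ∩ k.inv ⁻¹' k.domᶜ = ∅ := by
    ext x
    simp only [mem_inter_iff, mem_preimage, mem_compl_iff, k.inv_mem_dom]
    simp
  rw [this, setLIntegral_empty]

/-- The area element is at least one almost everywhere, so it creates no new null sets. Arbitrary
sets are allowed so that almost-everywhere statements transfer without a measurability check. -/
theorem measure_eq_zero_iff (S : Set E3) : k.measure S = 0 ↔ volume (k.U ∩ k.inv ⁻¹' S) = 0 := by
  constructor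
  · intro h
    obtain ⟨T, hST, hT, hT0⟩ := exists_measurable_superset_of_null h
    rw [k.measure_apply hT, lintegral_eq_zero_iff k.measurable_area.ennreal_ofReal] at hT0
    refine measure_mono_null (inter_subset_inter_right _ (preimage_mono hST)) ?_
    have hd : ∀ᵐ x ∂(volume.restrict (k.U ∩ k.inv ⁻¹' T)), DifferentiableAt ℝ k.patch.a x :=
      ae_mono (Measure.restrict_mono inter_subset_left le_rfl) k.ae_differentiableAt
    have : ∀ᵐ x ∂(volume.restrict (k.U ∩ k.inv ⁻¹' T)), False := by
      filter_upwards [hT0, hd] with x hx hdx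
      have := k.one_le_area hdx
      simp at hx
      linarith
    simpa [ae_iff] using this
  · intro h
    obtain ⟨T, hST, hT, hT0⟩ := exists_measurable_superset_of_null h
    have hsub : S ⊆ k.domᶜ ∪ (k.coord ⁻¹' T) := by
      intro z hz
      by_cases hd : z ∈ k.dom
      · right
        exact hST ⟨k.coord_mem hd, by rwa [mem_preimage, k.inv_coord hd]⟩
      · exact Or.inl hd
    refine measure_mono_null hsub (measure_union_null k.measure_compl_dom ?_)
    rw [k.measure_apply (k.continuous_coord.measurable hT)]
    refine setLIntegral_measure_zero _ _ (measure_mono_null ?_ hT0)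
    intro x hx
    simpa using hx.2

theorem ae_measure_iff {P : E3 → Prop} :
    (∀ᵐ ζ ∂k.measure, P ζ) ↔ ∀ᵐ x ∂(volume.restrict k.U), P (k.inv x) := by
  rw [ae_iff, k.measure_eq_zero_iff, ae_iff, Measure.restrict_apply' k.isOpen_U.measurableSet,
    inter_comm]
  rfl

theorem ae_mem_dom : ∀ᵐ ζ ∂k.measure, ζ ∈ k.dom := by
  rw [ae_iff]
  exact k.measure_compl_dom

theorem exists_slope_le : ∃ K : ℝ≥0, ∀ x ∈ k.U, ∀ j, |k.slope x j| ≤ K := by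
  obtain ⟨K, hK⟩ := k.patch.lipschitz_a
  refine ⟨K, fun x hx j => ?_⟩
  have h := norm_fderiv_le_of_lipschitzOn ℝ (k.isOpen_U.mem_nhds hx) (hK.mono k.U_subset)
  calc |k.slope x j| ≤ ‖fderiv ℝ k.patch.a x‖ * ‖e2 j‖ := (fderiv ℝ k.patch.a x).le_opNorm _
    _ ≤ K * 1 := by
      gcongr
      simp [e2]
    _ = K := mul_one _

theorem exists_area_le : ∃ C : ℝ, ∀ x ∈ k.U, DifferentiableAt ℝ k.patch.a x → k.area x ≤ C := by
  obtain ⟨K, hK⟩ := k.exists_slope_le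
  refine ⟨Real.sqrt (1 + K ^ 2 + K ^ 2), fun x hx h => ?_⟩
  rw [k.area_eq h, gramDet]
  have h0 := sq_le_sq' (neg_le_of_abs_le (hK x hx 0)) (le_of_abs_le (hK x hx 0))
  have h1 := sq_le_sq' (neg_le_of_abs_le (hK x hx 1)) (le_of_abs_le (hK x hx 1))
  gcongr

theorem volume_U_lt_top : volume k.U < ⊤ :=
  (measure_mono k.U_subset).trans_lt measure_ball_lt_top

instance isFiniteMeasure_measure : IsFiniteMeasure k.measure := by
  constructor
  obtain ⟨C, hC⟩ := k.exists_area_le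
  rw [k.measure_apply MeasurableSet.univ, preimage_univ, inter_univ]
  calc ∫⁻ x in k.U, ENNReal.ofReal (k.area x) ≤ ∫⁻ x in k.U, ENNReal.ofReal C := by
        refine lintegral_mono_ae ?_
        filter_upwards [k.ae_differentiableAt, ae_restrict_mem k.isOpen_U.measurableSet] with x h hx
        exact ENNReal.ofReal_le_ofReal (hC x hx h)
    _ < ⊤ := by
        rw [setLIntegral_const]
        exact ENNReal.mul_lt_top ENNReal.ofReal_lt_top k.volume_U_lt_top

/-! ### Change of charts -/

variable (m : Chart Ω)

/-- Null sets of parameters correspond to each other under a change of charts. -/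
theorem ae_transfer {P : E3 → Prop} (h : ∀ᵐ y ∂(volume.restrict m.U), P (m.inv y)) :
    ∀ᵐ x ∂(volume.restrict k.U), k.inv x ∈ m.dom → P (k.inv x) := by
  obtain ⟨K, hK⟩ := m.exists_lipschitzOnWith_inv
  obtain ⟨K', hK'⟩ := k.exists_lipschitzWith_coord
  rw [ae_iff, Measure.restrict_apply' m.isOpen_U.measurableSet] at h
  rw [ae_iff, Measure.restrict_apply' k.isOpen_U.measurableSet]
  -- The exceptional parameters of `k` are contained in the image of those of `m` under the
  -- transition map, which is Lipschitz.
  have hL : LipschitzOnWith (K' * K) (fun y => k.coord (m.inv y)) ({y | ¬P (m.inv y)} ∩ m.U) :=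
    hK'.comp_lipschitzOnWith (hK.mono inter_subset_right)
  refine measure_mono_null ?_ (volume_image_eq_zero_of_lipschitzOnWith hL h)
  rintro x ⟨hx, hxU⟩
  rw [mem_ofPred_eq, Classical.not_imp] at hx
  obtain ⟨hxm, hxP⟩ := hx
  refine ⟨m.coord (k.inv x), ⟨?_, m.coord_mem hxm⟩, ?_⟩
  · simpa [m.inv_coord hxm] using hxP
  · simp [m.inv_coord hxm]

theorem eventually_mem_dom {x : E2} (hx : x ∈ k.U) (hxm : k.inv x ∈ m.dom) :
    ∀ᶠ y in 𝓝 x, y ∈ k.U ∧ k.inv y ∈ m.dom := by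
  have hc : ContinuousAt k.inv x := k.continuousOn_inv.continuousAt (k.isOpen_U.mem_nhds hx)
  filter_upwards [k.isOpen_U.mem_nhds hx,
    hc.preimage_mem_nhds (m.isOpen_cyl.mem_nhds (m.dom_subset_cyl hxm))] with y hy hym
  exact ⟨hy, m.dom_eq ▸ ⟨k.inv_mem_frontier hy, hym⟩⟩

theorem hasFDerivAt_transition {x : E2} (h : DifferentiableAt ℝ k.patch.a x) :
    HasFDerivAt (fun y => m.coord (k.inv y)) (fderiv ℝ (fun y => m.coord (k.inv y)) x) x := by
  have h1 : DifferentiableAt ℝ k.inv x := (k.hasFDerivAt_inv h).differentiableAt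
  have h2 : DifferentiableAt ℝ m.coord (k.inv x) :=
    m.contDiff_coord.differentiable (by simp) _
  exact (h2.comp x h1).hasFDerivAt

/-- For the transition map `τ`, the chain rule gives `J_k = J_m Dτ`, so the Gram determinants differ
by the factor `(det Dτ)²`. -/
theorem area_transition {x : E2} (hx : x ∈ k.U) (hxm : k.inv x ∈ m.dom)
    (h : DifferentiableAt ℝ k.patch.a x) (hm : DifferentiableAt ℝ m.patch.a (m.coord (k.inv x))) :
    k.area x = |(fderiv ℝ (fun y => m.coord (k.inv y)) x).det| * m.area (m.coord (k.inv x)) := by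
  set τ := fun y => m.coord (k.inv y) with hτ
  set τ' := fderiv ℝ τ x with hτ'
  have hcomp : HasFDerivAt k.inv ((fderiv ℝ m.inv (τ x)).comp τ') x := by
    have h1 : HasFDerivAt m.inv (fderiv ℝ m.inv (τ x)) (τ x) :=
      (m.hasFDerivAt_inv hm).differentiableAt.hasFDerivAt
    refine (h1.comp x (k.hasFDerivAt_transition m h)).congr_of_eventuallyEq ?_
    filter_upwards [k.eventually_mem_dom m hx hxm] with y hy
    exact (m.inv_coord hy.2).symm
  let b := (EuclideanSpace.basisFun (Fin 2) ℝ).toBasis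
  set T := LinearMap.toMatrix b b (τ' : E2 →ₗ[ℝ] E2) with hT
  have hTdet : T.det = τ'.det := by rw [hT, LinearMap.det_toMatrix]
  have hJ : k.jac x = m.jac (τ x) * T := by
    ext i j
    have hTe (l : Fin 2) : τ' (e2 j) l = T l j := by
      simp [hT, LinearMap.toMatrix_apply, b, e2]
    have e : τ' (e2 j) = ∑ l, T l j • e2 l := by
      ext l
      rw [hTe]
      fin_cases l <;> simp [Fin.sum_univ_two, e2]
    have hc := congrArg (fun L : E2 →L[ℝ] E3 => L (e2 j)) hcomp.fderiv
    simp only [jac, Matrix.of_apply, Matrix.mul_apply]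
    simp only [ContinuousLinearMap.comp_apply, e, map_sum, map_smul] at hc
    rw [hc]
    simp [Fin.sum_univ_two, mul_comm]
  rw [area, area, hJ, Matrix.transpose_mul, Matrix.mul_assoc, ← Matrix.mul_assoc _ _ T,
    Matrix.det_mul, Matrix.det_mul, Matrix.det_transpose, hTdet, ← Real.sqrt_sq_eq_abs,
    ← Real.sqrt_mul (sq_nonneg _)]
  congr 1
  ring

/-- Change of variables along the transition map, together with `area_transition`. It is carried out
on the parameters where both graph functions are differentiable; by `ae_transfer` only null sets are
lost in either chart. -/
theorem measure_eq_of_subset {A : Set E3} (hA : MeasurableSet A) (hk : A ⊆ k.dom)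
    (hm : A ⊆ m.dom) : k.measure A = m.measure A := by
  obtain ⟨F, hF, hE⟩ := k.exists_continuous_ext
  set τ := fun y => m.coord (k.inv y) with hτ
  set S := {x | (x ∈ k.U ∧ k.inv x ∈ A) ∧ DifferentiableAt ℝ k.patch.a x ∧
    DifferentiableAt ℝ m.patch.a (τ x)} with hS
  have hSm : MeasurableSet S := by
    have : S = (k.U ∩ k.inv ⁻¹' A) ∩ ({x | DifferentiableAt ℝ k.patch.a x} ∩
        (fun y => m.coord (F y)) ⁻¹' {y | DifferentiableAt ℝ m.patch.a y}) := by
      ext x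
      simp only [hS, hτ, mem_ofPred_eq, mem_inter_iff, mem_preimage]
      refine and_congr_right fun hx => and_congr_right fun _ => ?_
      rw [hE hx.1]
    rw [this]
    exact (k.measurableSet_inter_preimage hA).inter
      ((measurableSet_of_differentiableAt ℝ _).inter
        ((m.continuous_coord.comp hF).measurable (measurableSet_of_differentiableAt ℝ _)))
  have hinj : InjOn τ S := by
    intro x hx y hy hxy
    have := congrArg m.inv hxy
    simp only [hτ, m.inv_coord (hm hx.1.2), m.inv_coord (hm hy.1.2)] at this
    exact k.injective_inv this
  have hcv := lintegral_image_eq_lintegral_abs_det_fderiv_mul volume hSm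
    (fun x hx => (k.hasFDerivAt_transition m hx.2.1).hasFDerivWithinAt) hinj
    (fun y => ENNReal.ofReal (m.area y))
  have hkm : ∀ᵐ x ∂(volume.restrict k.U), k.inv x ∈ m.dom → DifferentiableAt ℝ m.patch.a (τ x) :=
    k.ae_transfer m (P := fun ζ => DifferentiableAt ℝ m.patch.a (m.coord ζ))
      (by simpa using m.ae_differentiableAt)
  have hmk : ∀ᵐ y ∂(volume.restrict m.U), m.inv y ∈ k.dom →
      DifferentiableAt ℝ k.patch.a (k.coord (m.inv y)) :=
    m.ae_transfer k (P := fun ζ => DifferentiableAt ℝ k.patch.a (k.coord ζ))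
      (by simpa using k.ae_differentiableAt)
  have hk1 : (k.U ∩ k.inv ⁻¹' A : Set E2) =ᵐ[volume] S := by
    rw [ae_restrict_iff' k.isOpen_U.measurableSet] at hkm
    have hd := (ae_restrict_iff' k.isOpen_U.measurableSet).1 k.ae_differentiableAt
    filter_upwards [hkm, hd] with x h1 h2
    refine propext ⟨fun hx => ⟨hx, h2 hx.1, h1 hx.1 (hm hx.2)⟩, fun hx => hx.1⟩
  have hm1 : (m.U ∩ m.inv ⁻¹' A : Set E2) =ᵐ[volume] τ '' S := by
    rw [ae_restrict_iff' m.isOpen_U.measurableSet] at hmk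
    have hd := (ae_restrict_iff' m.isOpen_U.measurableSet).1 m.ae_differentiableAt
    filter_upwards [hmk, hd] with y h1 h2
    refine propext ⟨fun hy => ?_, ?_⟩
    · have hyk : m.inv y ∈ k.dom := hk hy.2
      refine ⟨k.coord (m.inv y), ⟨⟨k.coord_mem hyk, ?_⟩, h1 hy.1 hyk, ?_⟩, ?_⟩
      · rw [k.inv_coord hyk]; exact hy.2
      · simpa [hτ, k.inv_coord hyk] using h2 hy.1
      · simp [hτ, k.inv_coord hyk]
    · rintro ⟨x, hx, rfl⟩
      refine ⟨m.coord_mem (hm hx.1.2), ?_⟩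
      simp only [hτ, mem_preimage, m.inv_coord (hm hx.1.2)]
      exact hx.1.2
  rw [k.measure_apply hA, m.measure_apply hA, setLIntegral_congr hk1, setLIntegral_congr hm1, hcv]
  refine setLIntegral_congr_fun hSm fun x hx => ?_
  rw [k.area_transition m hx.1.1 (hm hx.1.2) hx.2.1 hx.2.2, ENNReal.ofReal_mul (abs_nonneg _)]

theorem measure_restrict_eq {A : Set E3} (hA : MeasurableSet A) (hk : A ⊆ k.dom)
    (hm : A ⊆ m.dom) : k.measure.restrict A = m.measure.restrict A := by
  ext S hS
  rw [Measure.restrict_apply hS, Measure.restrict_apply hS]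
  exact k.measure_eq_of_subset m (hS.inter hA) (inter_subset_right.trans hk)
    (inter_subset_right.trans hm)

/-! ### Independence of the outer normal from the chart. -/

theorem norm_normal (x : E2) : ‖k.normal x‖ = 1 := by
  rw [EuclideanSpace.norm_eq, Real.sqrt_eq_one]
  simpa [Fin.sum_univ_three] using k.sum_sq_normal x

/-- The height of a point over the graph along a line through a boundary point. -/
theorem hasDerivAt_height {x : E2} (h : DifferentiableAt ℝ k.patch.a x) (d : E3) :
    HasDerivAt (fun t : ℝ => inner ℝ k.patch.v (k.inv x + t • d - k.p)
      - k.patch.a (k.coord (k.inv x + t • d)))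
      (Real.sqrt (k.gramDet x) * inner ℝ (k.normal x) d) 0 := by
  have hline : HasDerivAt (fun t : ℝ => k.inv x + t • d) d 0 := by
    simpa using ((hasDerivAt_id (0 : ℝ)).smul_const d).const_add (k.inv x)
  have h1 : HasDerivAt (fun t : ℝ => inner ℝ k.patch.v (k.inv x + t • d - k.p))
      (inner ℝ k.patch.v d) 0 :=
    ((innerSL ℝ k.patch.v).hasFDerivAt.comp_hasDerivAt (0 : ℝ) (hline.sub_const k.p))
  have hc : HasDerivAt (fun t : ℝ => k.coord (k.inv x + t • d))
      (!₂[inner ℝ (k.patch.w 0) d, inner ℝ (k.patch.w 1) d] : E2) 0 := by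
    have e : (fun t : ℝ => k.coord (k.inv x + t • d))
        = fun t : ℝ => x + t • (!₂[inner ℝ (k.patch.w 0) d, inner ℝ (k.patch.w 1) d] : E2) := by
      funext t
      have hx := k.coord_inv x
      conv_rhs => rw [← hx]
      ext i
      fin_cases i <;>
        simp [coord, add_sub_right_comm, inner_add_right, inner_smul_right]
    rw [e]
    simpa using ((hasDerivAt_id (0 : ℝ)).smul_const
      (!₂[inner ℝ (k.patch.w 0) d, inner ℝ (k.patch.w 1) d] : E2)).const_add x
  have h2 : HasDerivAt (fun t : ℝ => k.patch.a (k.coord (k.inv x + t • d)))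
      (fderiv ℝ k.patch.a x (!₂[inner ℝ (k.patch.w 0) d, inner ℝ (k.patch.w 1) d] : E2)) 0 := by
    have hf : HasFDerivAt k.patch.a (fderiv ℝ k.patch.a x) (k.coord (k.inv x + (0 : ℝ) • d)) := by
      simpa using h.hasFDerivAt
    exact hf.comp_hasDerivAt (0 : ℝ) hc
  have hsplit : (!₂[inner ℝ (k.patch.w 0) d, inner ℝ (k.patch.w 1) d] : E2)
      = inner ℝ (k.patch.w 0) d • e2 0 + inner ℝ (k.patch.w 1) d • e2 1 := by
    ext i
    fin_cases i <;> simp [e2]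
  have hc : Real.sqrt (k.gramDet x) ≠ 0 := (Real.sqrt_pos.2 (k.gramDet_pos x)).ne'
  refine (h1.sub h2).congr_deriv ?_
  rw [hsplit, normal_eq, inner_smul_left]
  simp only [inner_add_left, inner_sub_left, inner_smul_left, map_add, map_smul, smul_eq_mul,
    slope, conj_trivial, map_neg]
  rw [mul_inv_cancel_left₀ hc]
  ring

/-- The normal is determined by `Ω`: a short ray in direction `d` enters `Ω` if `ν · d < 0` and
leaves it if `ν · d > 0`, in whichever chart `ν` is computed. Here it matters that `Ω` lies below
the graph in both charts; the boundary alone would fix the normal only up to sign. -/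
theorem normal_eq_normal {x y : E2} (hx : x ∈ k.U) (hy : y ∈ m.U) (hxy : k.inv x = m.inv y)
    (h : DifferentiableAt ℝ k.patch.a x) (hm : DifferentiableAt ℝ m.patch.a y) :
    k.normal x = m.normal y := by
  have key : ∀ d : E3, inner ℝ (k.normal x) d < 0 → inner ℝ (m.normal y) d ≤ 0 := by
    intro d hd
    by_contra! hpos
    have h1 := k.hasDerivAt_height h d
    have h2 := m.hasDerivAt_height hm d
    rw [hasDerivAt_iff_tendsto_slope] at h1 h2
    have s1 : Real.sqrt (k.gramDet x) * inner ℝ (k.normal x) d < 0 :=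
      mul_neg_of_pos_of_neg (Real.sqrt_pos.2 (k.gramDet_pos x)) hd
    have s2 : 0 < Real.sqrt (m.gramDet y) * inner ℝ (m.normal y) d :=
      mul_pos (Real.sqrt_pos.2 (m.gramDet_pos y)) hpos
    have hle : 𝓝[>] (0 : ℝ) ≤ 𝓝[≠] 0 := nhdsWithin_mono _ fun t ht => ne_of_gt ht
    have c1 := (h1.eventually (gt_mem_nhds s1)).filter_mono hle
    have c2 := (h2.eventually (lt_mem_nhds s2)).filter_mono hle
    have hcont : Tendsto (fun t : ℝ => k.inv x + t • d) (𝓝[>] 0) (𝓝 (k.inv x)) := by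
      have : Continuous fun t : ℝ => k.inv x + t • d := by fun_prop
      simpa using (this.tendsto 0).mono_left nhdsWithin_le_nhds
    have d1 := hcont.eventually (k.isOpen_cyl.mem_nhds (k.inv_mem_cyl.2 hx))
    have d2 := hcont.eventually (m.isOpen_cyl.mem_nhds (by rw [hxy]; exact m.inv_mem_cyl.2 hy))
    obtain ⟨t, ht1, ht2, hk, hm', ht⟩ :=
      (c1.and (c2.and (d1.and (d2.and self_mem_nhdsWithin)))).exists
    have ht0 : (0 : ℝ) < t := ht
    have z1 := k.mem_domain_iff hk
    have z2 := m.mem_domain_iff hm'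
    simp only [slope_def_field, sub_zero, zero_smul, add_zero, coord_inv,
      inner_v_inv, sub_self] at ht1 ht2
    rw [div_lt_iff₀ ht0, zero_mul] at ht1
    rw [lt_div_iff₀ ht0, zero_mul, ← hxy] at ht2
    have : k.inv x + t • d ∈ Ω := z1.2 (by linarith)
    have := z2.1 this
    linarith
  -- For distinct unit vectors, their difference has a negative product with the first and a
  -- positive product with the second, contradicting `key`.
  have hc := key (m.normal y - k.normal x)
  rw [inner_sub_right, inner_sub_right, real_inner_self_eq_norm_sq, real_inner_self_eq_norm_sq,
    norm_normal, norm_normal, real_inner_comm] at hc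
  have hle : inner ℝ (m.normal y) (k.normal x) ≤ 1 := by
    have := real_inner_le_norm (m.normal y) (k.normal x)
    rwa [norm_normal, norm_normal, one_mul] at this
  have : inner ℝ (m.normal y) (k.normal x) = 1 := by
    by_contra hne
    have hlt := lt_of_le_of_ne hle hne
    have := hc (by linarith)
    linarith
  exact ((inner_eq_one_iff_of_norm_eq_one (m.norm_normal y) (k.norm_normal x)).1 this).symm

end Chart

end ChartMeasure

section SurfaceMeasure

/-! ### The surface measure and the normal vector of the boundary -/

variable {Ω : Set E3}

theorem exists_atlas_spec (hΩ : IsStrongLipschitzDomain Ω) (hne : (frontier Ω).Nonempty) :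
    ∃ c : ℕ → Chart Ω, IsAtlas c ∧
      surfaceMeasure Ω = Measure.sum (fun n =>
        (c n).measure.restrict (disjointed (fun m => (c m).dom) n)) ∧
      ∀ ζ ∈ frontier Ω, ∃ n, ζ ∈ (c n).dom ∧ normal Ω ζ = (c n).normal ((c n).coord ζ) := by
  classical
  have H := exists_isAtlas hΩ hne
  refine ⟨H.choose, H.choose_spec, ?_, fun ζ hζ => ?_⟩
  · rw [surfaceMeasure, dif_pos H]
  · have h : ∃ n, ζ ∈ (H.choose n).dom := mem_iUnion.1 (H.choose_spec hζ)
    refine ⟨Nat.find h, Nat.find_spec h, ?_⟩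
    rw [normal, dif_pos H, dif_pos h]

theorem ae_of_forall_chart {P : E3 → Prop} (h : ∀ k : Chart Ω, ∀ᵐ ζ ∂k.measure, P ζ) :
    ∀ᵐ ζ ∂surfaceMeasure Ω, P ζ := by
  classical
  rw [surfaceMeasure]
  split_ifs with H
  · rw [Measure.ae_sum_iff]
    exact fun n => ae_restrict_of_ae (h _)
  · simp

theorem aestronglyMeasurable_of_forall_chart {β : Type*} [TopologicalSpace β]
    [TopologicalSpace.PseudoMetrizableSpace β] {f : E3 → β}
    (h : ∀ k : Chart Ω, AEStronglyMeasurable f k.measure) :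
    AEStronglyMeasurable f (surfaceMeasure Ω) := by
  classical
  rw [surfaceMeasure]
  split_ifs with H
  · exact AEStronglyMeasurable.sum_measure fun n => (h _).restrict
  · exact aestronglyMeasurable_zero_measure f

theorem norm_normal_le (ζ : E3) : ‖normal Ω ζ‖ ≤ 1 := by
  classical
  rw [normal]
  split_ifs
  · exact (Chart.norm_normal _ _).le
  · simp
  · simp

theorem ae_mem_frontier : ∀ᵐ ζ ∂surfaceMeasure Ω, ζ ∈ frontier Ω :=
  ae_of_forall_chart fun k => k.ae_mem_dom.mono fun _ h => k.dom_subset_frontier h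

namespace Chart

variable (k : Chart Ω)

/-- The pieces of the chosen atlas cut `Γ` into countably many parts, each contained in an atlas
chart and in `k`, where the two chart measures agree. This frees the later arguments from the choice
of atlas. -/
theorem surfaceMeasure_restrict_dom (hΩ : IsStrongLipschitzDomain Ω) :
    (surfaceMeasure Ω).restrict k.dom = k.measure := by
  obtain ⟨c, hc, hσ, -⟩ := exists_atlas_spec hΩ ⟨_, k.p_mem⟩
  have hm (n : ℕ) : MeasurableSet (disjointed (fun m => (c m).dom) n) :=
    MeasurableSet.disjointed (fun n => (c n).measurableSet_dom) n
  have hm' (n : ℕ) : MeasurableSet (k.dom ∩ disjointed (fun m => (c m).dom) n) :=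
    k.measurableSet_dom.inter (hm n)
  have hd : Pairwise (Function.onFun Disjoint
      fun n => k.dom ∩ disjointed (fun m => (c m).dom) n) := fun i j hij =>
    (disjoint_disjointed (fun m => (c m).dom) hij).mono inter_subset_right inter_subset_right
  have hU : (⋃ n, k.dom ∩ disjointed (fun m => (c m).dom) n) = k.dom := by
    rw [← inter_iUnion, iUnion_disjointed]
    exact inter_eq_left.2 (k.dom_subset_frontier.trans hc)
  have hk : k.measure = k.measure.restrict k.dom :=
    (Measure.restrict_eq_self_of_ae_mem k.ae_mem_dom).symm
  rw [hσ, Measure.restrict_sum _ k.measurableSet_dom, hk, ← hU,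
    Measure.restrict_iUnion hd hm', hU]
  congr 1
  ext1 n
  rw [Measure.restrict_restrict k.measurableSet_dom]
  exact (c n).measure_restrict_eq k (hm' n)
    (inter_subset_right.trans (disjointed_subset _ n)) inter_subset_left

theorem surfaceMeasure_restrict_cyl (hΩ : IsStrongLipschitzDomain Ω) :
    (surfaceMeasure Ω).restrict k.cyl = k.measure := by
  rw [← k.surfaceMeasure_restrict_dom hΩ]
  refine Measure.restrict_congr_set ?_
  filter_upwards [ae_mem_frontier] with ζ hζ
  rw [k.dom_eq]
  exact propext ⟨fun h => ⟨hζ, h⟩, fun h => h.2⟩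

theorem measure_le (hΩ : IsStrongLipschitzDomain Ω) : k.measure ≤ surfaceMeasure Ω := by
  rw [← k.surfaceMeasure_restrict_dom hΩ]
  exact Measure.restrict_le_self

theorem ae_inv_of_ae (hΩ : IsStrongLipschitzDomain Ω) {P : E3 → Prop}
    (h : ∀ᵐ ζ ∂surfaceMeasure Ω, P ζ) :
    ∀ᵐ x ∂(volume.restrict k.U), P (k.inv x) :=
  k.ae_measure_iff.1 (ae_mono (k.measure_le hΩ) h)

theorem ae_normal_inv (hΩ : IsStrongLipschitzDomain Ω) :
    ∀ᵐ x ∂(volume.restrict k.U), LipBdry.normal Ω (k.inv x) = k.normal x := by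
  obtain ⟨c, -, -, hn⟩ := exists_atlas_spec hΩ ⟨_, k.p_mem⟩
  have h : ∀ n, ∀ᵐ x ∂(volume.restrict k.U), k.inv x ∈ (c n).dom →
      DifferentiableAt ℝ (c n).patch.a ((c n).coord (k.inv x)) := fun n =>
    k.ae_transfer (c n) (P := fun ζ => DifferentiableAt ℝ (c n).patch.a ((c n).coord ζ))
      (by simpa using (c n).ae_differentiableAt)
  filter_upwards [ae_all_iff.2 h, k.ae_differentiableAt,
    ae_restrict_mem k.isOpen_U.measurableSet] with x hx hd hU
  obtain ⟨n, hnd, e⟩ := hn _ (k.inv_mem_frontier hU)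
  rw [e]
  exact ((k.normal_eq_normal (c n) hU ((c n).coord_mem hnd) ((c n).inv_coord hnd).symm hd
    (hx n hnd))).symm

theorem quasiMeasurePreserving_coord :
    Measure.QuasiMeasurePreserving k.coord k.measure (volume.restrict k.U) := by
  refine ⟨k.continuous_coord.measurable, Measure.AbsolutelyContinuous.mk fun N hN h => ?_⟩
  rw [Measure.map_apply k.continuous_coord.measurable hN, k.measure_eq_zero_iff]
  rw [Measure.restrict_apply hN, inter_comm] at h
  refine measure_mono_null ?_ h
  rintro x ⟨hx, hxN⟩
  exact ⟨hx, by simpa using hxN⟩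

theorem integral_measure {E : Type*} [NormedAddCommGroup E] [NormedSpace ℝ E] {f : E3 → E}
    (hf : AEStronglyMeasurable f k.measure) :
    ∫ ζ, f ζ ∂k.measure = ∫ x in k.U, k.area x • f (k.inv x) := by
  rw [measure, integral_map (k.aemeasurable_inv (withDensity_absolutelyContinuous _ _)) hf]
  have := integral_withDensity_eq_integral_toReal_smul (μ := volume.restrict k.U)
    k.measurable_area.ennreal_ofReal (Eventually.of_forall fun x => ENNReal.ofReal_lt_top)
    (fun x => f (k.inv x))
  refine this.trans (integral_congr_ae (Eventually.of_forall fun x => ?_))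
  simp only [area, ENNReal.toReal_ofReal (Real.sqrt_nonneg _)]

theorem integral_surfaceMeasure (hΩ : IsStrongLipschitzDomain Ω)
    {E : Type*} [NormedAddCommGroup E] [NormedSpace ℝ E] {f : E3 → E}
    (hf : AEStronglyMeasurable f (surfaceMeasure Ω)) (h0 : ∀ ζ, ζ ∉ k.cyl → f ζ = 0) :
    ∫ ζ, f ζ ∂surfaceMeasure Ω = ∫ x in k.U, k.area x • f (k.inv x) := by
  rw [← setIntegral_eq_integral_of_forall_compl_eq_zero h0, k.surfaceMeasure_restrict_cyl hΩ]
  exact k.integral_measure (hf.mono_measure (k.measure_le hΩ))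

/-- The lower bound `1` for the area element makes Lebesgue measure on `U` smaller than the weighted
one; its upper bound on `U` gives the opposite direction in `memLp_comp_coord`. -/
theorem memLp_comp_inv (hΩ : IsStrongLipschitzDomain Ω) {E : Type*} [NormedAddCommGroup E] {f : E3 → E}
    (hf : MemLp f 2 (surfaceMeasure Ω)) :
    MemLp (fun x => f (k.inv x)) 2 (volume.restrict k.U) := by
  have h1 : MemLp f 2 k.measure := hf.mono_measure (k.measure_le hΩ)
  have h2 : MemLp (f ∘ k.inv) 2 ((volume.restrict k.U).withDensity
      fun x => ENNReal.ofReal (k.area x)) :=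
    (memLp_map_measure_iff h1.1
      (k.aemeasurable_inv (withDensity_absolutelyContinuous _ _))).1 h1
  refine h2.mono_measure ?_
  conv_lhs => rw [← withDensity_one (μ := volume.restrict k.U)]
  refine withDensity_mono ?_
  filter_upwards [k.ae_differentiableAt] with x hx
  simpa using k.one_le_area hx

theorem memLp_comp_coord {E : Type*} [NormedAddCommGroup E] {g : E2 → E}
    (hg : MemLp g 2 (volume.restrict k.U)) : MemLp (fun ζ => g (k.coord ζ)) 2 k.measure := by
  have hm : AEStronglyMeasurable (fun ζ => g (k.coord ζ)) k.measure :=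
    hg.1.comp_quasiMeasurePreserving k.quasiMeasurePreserving_coord
  refine (memLp_map_measure_iff hm
    (k.aemeasurable_inv (withDensity_absolutelyContinuous _ _))).2 ?_
  have e : (fun ζ => g (k.coord ζ)) ∘ k.inv = g := by
    funext x; simp
  rw [e]
  obtain ⟨C, hC⟩ := k.exists_area_le
  refine (hg.smul_measure (c := ENNReal.ofReal C) ENNReal.ofReal_ne_top).mono_measure ?_
  rw [← withDensity_const]
  refine withDensity_mono ?_
  filter_upwards [k.ae_differentiableAt, ae_restrict_mem k.isOpen_U.measurableSet] with x h hx
  exact ENNReal.ofReal_le_ofReal (hC x hx h)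

theorem ae_normal_coord (hΩ : IsStrongLipschitzDomain Ω) :
    ∀ᵐ ζ ∂k.measure, LipBdry.normal Ω ζ = k.normal (k.coord ζ) := by
  rw [k.ae_measure_iff]
  simpa using k.ae_normal_inv hΩ

end Chart

theorem aestronglyMeasurable_normal (hΩ : IsStrongLipschitzDomain Ω) :
    AEStronglyMeasurable (normal Ω) (surfaceMeasure Ω) :=
  aestronglyMeasurable_of_forall_chart fun k =>
    ((k.measurable_normal.comp k.continuous_coord.measurable).aestronglyMeasurable).congr
      (EventuallyEq.symm (k.ae_normal_coord hΩ))

theorem isLocallyFiniteMeasure_surfaceMeasure (hΩ : IsStrongLipschitzDomain Ω) :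
    IsLocallyFiniteMeasure (surfaceMeasure Ω) := by
  refine ⟨fun ζ => ?_⟩
  by_cases hζ : ζ ∈ frontier Ω
  · obtain ⟨k, hk⟩ := exists_chart hΩ hζ
    refine ⟨k.cyl, k.isOpen_cyl.mem_nhds (k.dom_subset_cyl hk), ?_⟩
    rw [← Measure.restrict_apply_univ, k.surfaceMeasure_restrict_cyl hΩ]
    exact measure_lt_top _ _
  · refine ⟨(frontier Ω)ᶜ, isClosed_frontier.isOpen_compl.mem_nhds hζ, ?_⟩
    have : surfaceMeasure Ω (frontier Ω)ᶜ = 0 := ae_mem_frontier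
    simp [this]

end SurfaceMeasure

section Approximation

/-! ### Smooth approximation of Lipschitz functions -/

open scoped Convolution in
-- Mollification. The derivative can be moved onto `A`, so `D(φ ⋆ A) = φ ⋆ DA`: this yields the
-- uniform bound `K` and, by Lebesgue differentiation, convergence of the gradients almost
-- everywhere. The last clause keeps supports under control.
theorem exists_contDiff_approx {A : E2 → ℝ} {K : ℝ≥0} (hA : LipschitzWith K A) :
    ∃ B : ℕ → E2 → ℝ, (∀ n, ContDiff ℝ ∞ (B n)) ∧ (∀ n x, ‖fderiv ℝ (B n) x‖ ≤ K) ∧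
      (∀ x, Tendsto (fun n => B n x) atTop (𝓝 (A x))) ∧ (∀ n x, |B n x - A x| ≤ K) ∧
      (∀ᵐ x, Tendsto (fun n => fderiv ℝ (B n) x) atTop (𝓝 (fderiv ℝ A x))) ∧
      ∀ δ > 0, ∀ᶠ n in atTop, ∀ x, B n x ≠ 0 → ∃ y, A y ≠ 0 ∧ dist x y ≤ δ := by
  -- The outer radius is at most `1`, which gives the bound `K` on the error, and at most twice the
  -- inner one, as the differentiation theorem requires.
  let φ : ℕ → ContDiffBump (0 : E2) := fun n =>
    ⟨1 / (n + 2), 2 / (n + 2), by positivity, by gcongr; norm_num⟩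
  have hr : Tendsto (fun n => (φ n).rOut) atTop (𝓝 0) := by
    have h1 : Tendsto (fun n : ℕ => (n : ℝ) + 2) atTop atTop :=
      tendsto_atTop_add_const_right _ _ tendsto_natCast_atTop_atTop
    exact h1.const_div_atTop 2
  have hAl : LocallyIntegrable A volume := hA.continuous.locallyIntegrable
  have hDl : LocallyIntegrable (fderiv ℝ A) volume := by
    refine (memLp_top_of_bound (measurable_fderiv ℝ A).aestronglyMeasurable K
      (Eventually.of_forall fun x => ?_)).locallyIntegrable le_top
    exact norm_fderiv_le_of_lipschitz ℝ hA
  have hφi (n : ℕ) : Integrable ((φ n).normed volume) := (φ n).integrable_normed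
  have hderiv (n : ℕ) (x : E2) : HasFDerivAt
      ((φ n).normed volume ⋆[ContinuousLinearMap.lsmul ℝ ℝ, volume] A)
      (((φ n).normed volume ⋆[ContinuousLinearMap.lsmul ℝ ℝ, volume] (fderiv ℝ A)) x) x := by
    have hAc := hA.continuous
    have hφc : Continuous ((φ n).normed volume) := (φ n).continuous_normed
    -- For fixed `x`, Rademacher makes `A` differentiable at `x - t` for almost every `t`, and the
    -- Lipschitz bound dominates the difference quotients.
    refine (hasFDerivAt_integral_of_dominated_loc_of_lip (s := univ)
      (bound := fun t => (φ n).normed volume t * K)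
      (F := fun x t => (φ n).normed volume t • A (x - t))
      (F' := fun t => (φ n).normed volume t • fderiv ℝ A (x - t)) univ_mem
      (Eventually.of_forall fun y => ?_) ?_ ?_ ?_ ((hφi n).mul_const _) ?_).2
    · exact Continuous.aestronglyMeasurable (by fun_prop)
    · refine Continuous.integrable_of_hasCompactSupport (by fun_prop) ?_
      exact (φ n).hasCompactSupport_normed.smul_right
    · have h1 : Measurable (fun t => fderiv ℝ A (x - t)) :=
        (measurable_fderiv ℝ A).comp (measurable_const.sub measurable_id)
      exact hφc.aestronglyMeasurable.smul h1.aestronglyMeasurable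
    · refine Eventually.of_forall fun t => LipschitzOnWith.of_dist_le_mul fun y _ z _ => ?_
      have hn : 0 ≤ (φ n).normed volume t := (φ n).nonneg_normed t
      have := hA.dist_le_mul (y - t) (z - t)
      rw [dist_sub_right] at this
      rw [dist_smul₀, Real.norm_of_nonneg hn, Real.coe_nnabs,
        abs_of_nonneg (by positivity), mul_assoc]
      gcongr
    · have hq := (volume.measurePreserving_sub_left x).quasiMeasurePreserving.ae
        hA.ae_differentiableAt
      filter_upwards [hq] with t ht
      have h1 : HasFDerivAt (fun y : E2 => y - t) (ContinuousLinearMap.id ℝ E2) x :=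
        (hasFDerivAt_id x).sub_const t
      have h2 : HasFDerivAt (fun y => A (y - t)) (fderiv ℝ A (x - t)) x :=
        ht.hasFDerivAt.comp x h1
      exact h2.const_smul ((φ n).normed volume t)
  refine ⟨fun n => (φ n).normed volume ⋆[ContinuousLinearMap.lsmul ℝ ℝ, volume] A,
    fun n => ?_, fun n x => ?_, fun x => ?_, fun n x => ?_, ?_, fun δ hδ => ?_⟩
  · exact (φ n).hasCompactSupport_normed.contDiff_convolution_left _ (φ n).contDiff_normed hAl
  · rw [(hderiv n x).fderiv]
    have : ∫ t, (φ n).normed volume t * (K : ℝ) = K := by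
      rw [integral_mul_const, (φ n).integral_normed, one_mul]
    rw [← this]
    refine norm_integral_le_of_norm_le ((hφi n).mul_const _) (Eventually.of_forall fun t => ?_)
    have hn : 0 ≤ (φ n).normed volume t := (φ n).nonneg_normed t
    rw [ContinuousLinearMap.lsmul_apply, norm_smul, Real.norm_of_nonneg hn]
    gcongr
    exact norm_fderiv_le_of_lipschitz ℝ hA
  · exact ContDiffBump.convolution_tendsto_right_of_continuous hr hA.continuous x
  · refine (φ n).dist_normed_convolution_le hA.continuous.aestronglyMeasurable fun y hy => ?_
    have h1 : dist y x < 2 / (n + 2) := hy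
    have h2 : (2 : ℝ) / (n + 2) ≤ 1 := by
      rw [div_le_one (by positivity)]
      linarith [n.cast_nonneg (α := ℝ)]
    calc dist (A y) (A x) ≤ K * dist y x := hA.dist_le_mul y x
      _ ≤ K * 1 := by gcongr; linarith
      _ = K := mul_one _
  · have := ContDiffBump.ae_convolution_tendsto_right_of_locallyIntegrable (K := 2) hr
      (Eventually.of_forall fun n => by
        change (2 : ℝ) / (n + 2) ≤ 2 * (1 / (n + 2)); rw [mul_one_div]) hDl
    filter_upwards [this] with x hx
    simpa only [(hderiv _ x).fderiv] using hx
  · filter_upwards [hr.eventually (gt_mem_nhds hδ)] with n hn x hx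
    by_contra! hcon
    refine hx ?_
    rw [convolution_def]
    refine integral_eq_zero_of_ae (Eventually.of_forall fun t => ?_)
    by_cases ht : t ∈ Function.support ((φ n).normed volume)
    · rw [(φ n).support_normed_eq, mem_ball_zero_iff] at ht
      have : A (x - t) = 0 := by
        by_contra hne
        have := hcon _ hne
        rw [dist_eq_norm, sub_sub_cancel] at this
        linarith
      simp [this]
    · rw [Function.notMem_support] at ht
      simp [ht]

/-! ### Integration by parts against a Lipschitz Jacobian -/

variable {𝕜 : Type*} [RCLike 𝕜]

theorem integrable_ofReal_mul {U : Set E2} {u : E2 → 𝕜} (hu : Integrable u (volume.restrict U))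
    {φ : E2 → ℝ} (hφ : AEStronglyMeasurable φ (volume.restrict U)) {C : ℝ}
    (hC : ∀ x, |φ x| ≤ C) :
    Integrable (fun x => (φ x : 𝕜) * u x) (volume.restrict U) := by
  refine hu.bdd_mul (c := C) (RCLike.continuous_ofReal.comp_aestronglyMeasurable hφ)
    (Eventually.of_forall fun x => ?_)
  simpa using hC x

theorem abs_fderiv_e2_le {A : E2 → ℝ} {x : E2} {K : ℝ} (h : ‖fderiv ℝ A x‖ ≤ K) (i : Fin 2) :
    |fderiv ℝ A x (e2 i)| ≤ K := by
  have := (fderiv ℝ A x).le_opNorm (e2 i)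
  simp [e2] at this
  exact this.trans h

theorem abs_mul_sub_mul_le {a b c d K L : ℝ} (ha : |a| ≤ L) (hb : |b| ≤ K) (hc : |c| ≤ L)
    (hd : |d| ≤ K) : |a * b - c * d| ≤ L * K + L * K := by
  have hL : 0 ≤ L := (abs_nonneg _).trans ha
  calc |a * b - c * d| ≤ |a * b| + |c * d| := abs_sub _ _
    _ ≤ L * K + L * K := by
      rw [abs_mul, abs_mul]
      gcongr

/-- By symmetry of second derivatives the Jacobian is the divergence `∂₀(ψ ∂₁A) - ∂₁(ψ ∂₀A)`, and
the functions `ψ ∂ⱼA` are admissible test functions for the weak gradient. -/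
theorem HasWeakGradOn.integral_jacobian_of_contDiff {U : Set E2} {u : E2 → 𝕜} {g : E2 → V2 𝕜}
    (hw : HasWeakGradOn U u g) (hu : Integrable u (volume.restrict U))
    (hg : Integrable g (volume.restrict U)) {A ψ : E2 → ℝ} (hA : ContDiff ℝ ∞ A)
    (hψ : ContDiff ℝ ∞ ψ) (hc : HasCompactSupport ψ) (hs : tsupport ψ ⊆ U) :
    ∫ x in U, ((fderiv ℝ ψ x (e2 0) * fderiv ℝ A x (e2 1)
        - fderiv ℝ ψ x (e2 1) * fderiv ℝ A x (e2 0) : ℝ) : 𝕜) * u x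
      = -∫ x in U, (((ψ x * fderiv ℝ A x (e2 1) : ℝ) : 𝕜) * g x 0
        - ((ψ x * fderiv ℝ A x (e2 0) : ℝ) : 𝕜) * g x 1) := by
  have hD (j : Fin 2) : ContDiff ℝ ∞ fun x => fderiv ℝ A x (e2 j) :=
    (hA.fderiv_right (by simp)).clm_apply contDiff_const
  have hφ (j : Fin 2) : ContDiff ℝ ∞ fun x => ψ x * fderiv ℝ A x (e2 j) := hψ.mul (hD j)
  have hcφ (j : Fin 2) : HasCompactSupport fun x => ψ x * fderiv ℝ A x (e2 j) := hc.mul_right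
  have hsφ (j : Fin 2) : tsupport (fun x => ψ x * fderiv ℝ A x (e2 j)) ⊆ U :=
    (tsupport_mul_subset_left).trans hs
  have hbd (j : Fin 2) : ∃ C, ∀ x, |ψ x * fderiv ℝ A x (e2 j)| ≤ C := by
    obtain ⟨C, hC⟩ := (hcφ j).exists_bound_of_continuous (hφ j).continuous
    exact ⟨C, hC⟩
  have hDφ (i j : Fin 2) : Continuous fun x =>
      fderiv ℝ (fun x => ψ x * fderiv ℝ A x (e2 j)) x (e2 i) :=
    (((hφ j).fderiv_right (m := ∞) (by simp)).clm_apply contDiff_const).continuous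
  have hbdD (i j : Fin 2) : ∃ C, ∀ x,
      |fderiv ℝ (fun x => ψ x * fderiv ℝ A x (e2 j)) x (e2 i)| ≤ C := by
    have : HasCompactSupport fun x => fderiv ℝ (fun x => ψ x * fderiv ℝ A x (e2 j)) x (e2 i) :=
      (hcφ j).fderiv_apply ℝ (e2 i)
    obtain ⟨C, hC⟩ := this.exists_bound_of_continuous (hDφ i j)
    exact ⟨C, hC⟩
  have hgi (j : Fin 2) : Integrable (fun x => g x j) (volume.restrict U) :=
    (EuclideanSpace.proj (𝕜 := 𝕜) j : V2 𝕜 →L[𝕜] 𝕜).integrable_comp hg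
  have e0 := hw _ (hφ 1) (hcφ 1) (hsφ 1) 0
  have e1 := hw _ (hφ 0) (hcφ 0) (hsφ 0) 1
  have I0 : Integrable (fun x => ((fderiv ℝ (fun x => ψ x * fderiv ℝ A x (e2 1)) x (e2 0) : ℝ) : 𝕜)
      * u x) (volume.restrict U) :=
    integrable_ofReal_mul hu (hDφ 0 1).aestronglyMeasurable (hbdD 0 1).choose_spec
  have I1 : Integrable (fun x => ((fderiv ℝ (fun x => ψ x * fderiv ℝ A x (e2 0)) x (e2 1) : ℝ) : 𝕜)
      * u x) (volume.restrict U) :=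
    integrable_ofReal_mul hu (hDφ 1 0).aestronglyMeasurable (hbdD 1 0).choose_spec
  have J0 : Integrable (fun x => ((ψ x * fderiv ℝ A x (e2 1) : ℝ) : 𝕜) * g x 0)
      (volume.restrict U) :=
    integrable_ofReal_mul (hgi 0) (hφ 1).continuous.aestronglyMeasurable (hbd 1).choose_spec
  have J1 : Integrable (fun x => ((ψ x * fderiv ℝ A x (e2 0) : ℝ) : 𝕜) * g x 1)
      (volume.restrict U) :=
    integrable_ofReal_mul (hgi 1) (hφ 0).continuous.aestronglyMeasurable (hbd 0).choose_spec
  have hpt (x : E2) : fderiv ℝ ψ x (e2 0) * fderiv ℝ A x (e2 1)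
        - fderiv ℝ ψ x (e2 1) * fderiv ℝ A x (e2 0)
      = fderiv ℝ (fun x => ψ x * fderiv ℝ A x (e2 1)) x (e2 0)
        - fderiv ℝ (fun x => ψ x * fderiv ℝ A x (e2 0)) x (e2 1) := by
    have hψd : DifferentiableAt ℝ ψ x := hψ.differentiable (by simp) x
    have hDA : DifferentiableAt ℝ (fderiv ℝ A) x :=
      (hA.fderiv_right (m := ∞) (by simp)).differentiable (by simp) x
    have hsnd (i j : Fin 2) : fderiv ℝ (fun x => fderiv ℝ A x (e2 j)) x (e2 i)
        = fderiv ℝ (fderiv ℝ A) x (e2 i) (e2 j) := by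
      rw [fderiv_clm_apply hDA (differentiableAt_const _)]
      simp
    have hsym : fderiv ℝ (fderiv ℝ A) x (e2 0) (e2 1) = fderiv ℝ (fderiv ℝ A) x (e2 1) (e2 0) :=
      (hA.contDiffAt (x := x)).isSymmSndFDerivAt (by
        rw [minSmoothness_of_isRCLikeNormedField]
        exact WithTop.coe_le_coe.2 (le_top : (2 : ℕ∞) ≤ ⊤)) (e2 0) (e2 1)
    have hDd (j : Fin 2) : DifferentiableAt ℝ (fun x => fderiv ℝ A x (e2 j)) x :=
      (hD j).differentiable (by simp) x
    rw [fderiv_fun_mul hψd (hDd 1), fderiv_fun_mul hψd (hDd 0)]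
    simp only [add_apply, smul_apply, hsnd, hsym,
      smul_eq_mul]
    ring
  simp only [hpt]
  push_cast [sub_mul] at *
  rw [integral_sub I0 I1, integral_sub J0 J1, e0, e1]
  ring

/-- Only first derivatives of `A` and `ψ` occur on either side. Mollifying both and using bounded,
almost everywhere convergent gradients, dominated convergence reduces to the smooth case. -/
theorem HasWeakGradOn.integral_jacobian {U : Set E2} (hU : IsOpen U) {u : E2 → 𝕜} {g : E2 → V2 𝕜}
    (hw : HasWeakGradOn U u g) (hu : Integrable u (volume.restrict U))
    (hg : Integrable g (volume.restrict U)) {A ψ : E2 → ℝ} {K L : ℝ≥0} (hA : LipschitzWith K A)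
    (hψ : LipschitzWith L ψ) (hc : HasCompactSupport ψ) (hs : tsupport ψ ⊆ U) :
    ∫ x in U, ((fderiv ℝ ψ x (e2 0) * fderiv ℝ A x (e2 1)
        - fderiv ℝ ψ x (e2 1) * fderiv ℝ A x (e2 0) : ℝ) : 𝕜) * u x
      = -∫ x in U, (((ψ x * fderiv ℝ A x (e2 1) : ℝ) : 𝕜) * g x 0
        - ((ψ x * fderiv ℝ A x (e2 0) : ℝ) : 𝕜) * g x 1) := by
  obtain ⟨B, hBs, hBb, -, -, hBD, -⟩ := exists_contDiff_approx hA
  obtain ⟨P, hPs, hPb, hP, hPA, hPD, hPsupp⟩ := exists_contDiff_approx hψ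
  -- Room for the supports of the mollified test functions, which lie in this thickening for all
  -- large `n`.
  obtain ⟨δ, hδ, hδU⟩ := hc.isCompact.exists_cthickening_subset_open hU hs
  obtain ⟨C, hC⟩ := hc.exists_bound_of_continuous hψ.continuous
  have hPC (n : ℕ) (x : E2) : |P n x| ≤ L + C := by
    have h1 := hPA n x
    have h2 := hC x
    rw [Real.norm_eq_abs] at h2
    calc |P n x| = |(P n x - ψ x) + ψ x| := by rw [sub_add_cancel]
      _ ≤ L + C := (abs_add_le _ _).trans (add_le_add h1 h2)
  have hgi (j : Fin 2) : Integrable (fun x => g x j) (volume.restrict U) :=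
    (EuclideanSpace.proj (𝕜 := 𝕜) j : V2 𝕜 →L[𝕜] 𝕜).integrable_comp hg
  have hDc {f : E2 → ℝ} (hf : ContDiff ℝ ∞ f) (j : Fin 2) :
      Continuous fun x => fderiv ℝ f x (e2 j) :=
    ((hf.fderiv_right (m := ∞) (by simp)).clm_apply contDiff_const).continuous
  have htendsto {f : ℕ → E2 → ℝ} {f' : E2 → ℝ} {x : E2}
      (h : Tendsto (fun n => fderiv ℝ (f n) x) atTop (𝓝 (fderiv ℝ f' x))) (j : Fin 2) :
      Tendsto (fun n => fderiv ℝ (f n) x (e2 j)) atTop (𝓝 (fderiv ℝ f' x (e2 j))) :=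
    (((ContinuousLinearMap.apply ℝ ℝ (e2 j)).continuous.tendsto _).comp h :)
  have hof {f : ℕ → ℝ} {a : ℝ} (h : Tendsto f atTop (𝓝 a)) :
      Tendsto (fun n => (f n : 𝕜)) atTop (𝓝 (a : 𝕜)) :=
    (RCLike.continuous_ofReal.tendsto a).comp h
  have lim1 : Tendsto (fun n => ∫ x in U, ((fderiv ℝ (P n) x (e2 0) * fderiv ℝ (B n) x (e2 1)
        - fderiv ℝ (P n) x (e2 1) * fderiv ℝ (B n) x (e2 0) : ℝ) : 𝕜) * u x) atTop
      (𝓝 (∫ x in U, ((fderiv ℝ ψ x (e2 0) * fderiv ℝ A x (e2 1)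
        - fderiv ℝ ψ x (e2 1) * fderiv ℝ A x (e2 0) : ℝ) : 𝕜) * u x)) := by
    refine tendsto_integral_of_dominated_convergence (fun x => (L * K + L * K : ℝ) * ‖u x‖)
      (fun n => ?_) (hu.norm.const_mul _) (fun n => Eventually.of_forall fun x => ?_) ?_
    · refine AEStronglyMeasurable.mul ?_ hu.1
      have h0 := hDc (hPs n)
      have h1 := hDc (hBs n)
      exact (RCLike.continuous_ofReal.comp (by fun_prop)).aestronglyMeasurable
    · rw [norm_mul, RCLike.norm_ofReal]
      gcongr
      exact abs_mul_sub_mul_le (abs_fderiv_e2_le (hPb n x) _) (abs_fderiv_e2_le (hBb n x) _)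
        (abs_fderiv_e2_le (hPb n x) _) (abs_fderiv_e2_le (hBb n x) _)
    · filter_upwards [ae_restrict_of_ae hBD, ae_restrict_of_ae hPD] with x hx hx'
      refine Tendsto.mul_const _ (hof ?_)
      exact ((htendsto hx' 0).mul (htendsto hx 1)).sub ((htendsto hx' 1).mul (htendsto hx 0))
  have lim2 : Tendsto (fun n => ∫ x in U, (((P n x * fderiv ℝ (B n) x (e2 1) : ℝ) : 𝕜) * g x 0
        - ((P n x * fderiv ℝ (B n) x (e2 0) : ℝ) : 𝕜) * g x 1)) atTop
      (𝓝 (∫ x in U, (((ψ x * fderiv ℝ A x (e2 1) : ℝ) : 𝕜) * g x 0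
        - ((ψ x * fderiv ℝ A x (e2 0) : ℝ) : 𝕜) * g x 1))) := by
    refine tendsto_integral_of_dominated_convergence
      (fun x => ((L + C) * K : ℝ) * ‖g x 0‖ + ((L + C) * K : ℝ) * ‖g x 1‖)
      (fun n => ?_) (((hgi 0).norm.const_mul _).add ((hgi 1).norm.const_mul _))
      (fun n => Eventually.of_forall fun x => ?_) ?_
    · have h0 := (hPs n).continuous
      have h1 := hDc (hBs n)
      exact ((RCLike.continuous_ofReal.comp (by fun_prop)).aestronglyMeasurable.mul (hgi 0).1).sub
        ((RCLike.continuous_ofReal.comp (by fun_prop)).aestronglyMeasurable.mul (hgi 1).1)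
    · have hb (j : Fin 2) : |P n x * fderiv ℝ (B n) x (e2 j)| ≤ (L + C) * K := by
        rw [abs_mul]
        exact mul_le_mul (hPC n x) (abs_fderiv_e2_le (hBb n x) j) (abs_nonneg _)
          ((abs_nonneg _).trans (hPC n x))
      refine (norm_sub_le _ _).trans ?_
      rw [norm_mul, norm_mul, RCLike.norm_ofReal, RCLike.norm_ofReal]
      exact add_le_add (mul_le_mul_of_nonneg_right (hb 1) (norm_nonneg _))
        (mul_le_mul_of_nonneg_right (hb 0) (norm_nonneg _))
    · filter_upwards [ae_restrict_of_ae hBD] with x hx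
      exact ((hof ((hP x).mul (htendsto hx 1))).mul_const _).sub
        ((hof ((hP x).mul (htendsto hx 0))).mul_const _)
  refine tendsto_nhds_unique lim1 (lim2.neg.congr' ?_)
  filter_upwards [hPsupp δ hδ] with n hn
  have hsub : tsupport (P n) ⊆ Metric.cthickening δ (tsupport ψ) := by
    refine closure_minimal (fun x hx => ?_) Metric.isClosed_cthickening
    obtain ⟨y, hy, hxy⟩ := hn x hx
    exact Metric.mem_cthickening_of_dist_le x y δ _ (subset_tsupport _ hy) hxy
  refine (hw.integral_jacobian_of_contDiff hu hg (hBs n) (hPs n) ?_ (hsub.trans hδU)).symm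
  exact hc.isCompact.cthickening.of_isClosed_subset (isClosed_tsupport _) hsub

end Approximation

section WeakForm

variable {𝕜 : Type*} [RCLike 𝕜] {Ω : Set E3}

/-! ### The cross product with the normal vector -/

/-- The gradient of a real function as a vector with entries in `𝕜`. -/
def gradV (ψ : E3 → ℝ) (ζ : E3) : V3 𝕜 :=
  WithLp.toLp 2 fun i => ((fderiv ℝ ψ ζ (e3 i) : ℝ) : 𝕜)

theorem continuous_crossV (i : Fin 3) :
    Continuous fun p : E3 × V3 𝕜 => crossV p.1 p.2 i := by
  have h (j : Fin 3) : Continuous fun p : E3 × V3 𝕜 => (p.1 j : 𝕜) :=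
    RCLike.continuous_ofReal.comp (by fun_prop)
  fin_cases i <;> simp only [crossV, crossProduct] <;> simp <;> fun_prop

theorem crossV_add (n : E3) (y z : V3 𝕜) (i : Fin 3) :
    crossV n (y + z) i = crossV n y i + crossV n z i := by
  fin_cases i <;> simp [crossV, crossProduct] <;> ring

theorem crossV_sub (n : E3) (y z : V3 𝕜) (i : Fin 3) :
    crossV n (y - z) i = crossV n y i - crossV n z i := by
  fin_cases i <;> simp [crossV, crossProduct] <;> ring

@[simp] theorem crossV_zero (n : E3) (i : Fin 3) : crossV n (0 : V3 𝕜) i = 0 := by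
  fin_cases i <;> simp [crossV, crossProduct]

theorem norm_crossV_apply_le {n : E3} (hn : ‖n‖ ≤ 1) (z : V3 𝕜) (i : Fin 3) :
    ‖crossV n z i‖ ≤ 2 * ‖z‖ := by
  have h (a b : Fin 3) : ‖(n a : 𝕜) * z b‖ ≤ ‖z‖ := by
    rw [norm_mul, RCLike.norm_ofReal]
    calc |n a| * ‖z b‖ ≤ 1 * ‖z‖ :=
          mul_le_mul ((PiLp.norm_apply_le n a).trans hn) (PiLp.norm_apply_le z b)
            (norm_nonneg _) zero_le_one
      _ = ‖z‖ := one_mul _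
  have h2 (a b c d : Fin 3) : ‖(n a : 𝕜) * z b - (n c : 𝕜) * z d‖ ≤ 2 * ‖z‖ :=
    (norm_sub_le _ _).trans (by linarith [h a b, h c d])
  fin_cases i <;> simp [crossV, crossProduct] <;> apply h2

/-- For a unit vector, `z = (n · z) n - n × (n × z)`. -/
theorem eq_zero_of_crossV_eq_zero {n : E3} (hn : n 0 ^ 2 + n 1 ^ 2 + n 2 ^ 2 = 1) {z : V3 𝕜}
    (hz : dotV n z = 0) (hc : ∀ i, crossV n z i = 0) : z = 0 := by
  have h0 := hc 0
  have h1 := hc 1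
  have h2 := hc 2
  have hn' := congrArg (RCLike.ofReal (K := 𝕜)) hn
  push_cast at hn'
  simp [crossV, crossProduct] at h0 h1 h2
  simp only [dotV, Fin.sum_univ_three] at hz
  ext i
  fin_cases i <;> simp
  · linear_combination (-z 0) * hn' + (n 0 : 𝕜) * hz - (n 2 : 𝕜) * h1 * (-1) - (n 1 : 𝕜) * h2
  · linear_combination (-z 1) * hn' + (n 1 : 𝕜) * hz - (n 0 : 𝕜) * h2 * (-1) - (n 2 : 𝕜) * h0
  · linear_combination (-z 2) * hn' + (n 2 : 𝕜) * hz - (n 1 : 𝕜) * h0 * (-1) - (n 0 : 𝕜) * h1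

theorem aestronglyMeasurable_crossV_normal (hΩ : IsStrongLipschitzDomain Ω) {q : E3 → V3 𝕜}
    (hq : AEStronglyMeasurable q (surfaceMeasure Ω)) (i : Fin 3) :
    AEStronglyMeasurable (fun ζ => crossV (normal Ω ζ) (q ζ) i) (surfaceMeasure Ω) :=
  (continuous_crossV (𝕜 := 𝕜) i).comp_aestronglyMeasurable (f := fun ζ => (normal Ω ζ, q ζ))
    ((aestronglyMeasurable_normal hΩ).prodMk hq)

theorem memLp_crossV_normal (hΩ : IsStrongLipschitzDomain Ω) {q : E3 → V3 𝕜}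
    (hq : MemLp q 2 (surfaceMeasure Ω)) (i : Fin 3) :
    MemLp (fun ζ => crossV (normal Ω ζ) (q ζ) i) 2 (surfaceMeasure Ω) :=
  hq.of_le_mul (aestronglyMeasurable_crossV_normal hΩ hq.1 i)
    (Eventually.of_forall fun ζ => norm_crossV_apply_le (norm_normal_le ζ) _ i)

theorem continuous_gradV {ψ : E3 → ℝ} (hψ : ContDiff ℝ ∞ ψ) :
    Continuous (gradV (𝕜 := 𝕜) ψ) := by
  have h (i : Fin 3) : Continuous fun ζ => fderiv ℝ ψ ζ (e3 i) :=
    ((hψ.fderiv_right (m := ∞) (by simp)).clm_apply contDiff_const).continuous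
  exact (PiLp.continuous_toLp 2 _).comp
    (continuous_pi fun i => RCLike.continuous_ofReal.comp (h i))

theorem gradV_eq_zero {ψ : E3 → ℝ} {ζ : E3} (h : ζ ∉ tsupport ψ) : gradV (𝕜 := 𝕜) ψ ζ = 0 := by
  ext i
  simp [gradV, fderiv_of_notMem_tsupport ℝ h]

theorem memLp_gradV (hΩ : IsStrongLipschitzDomain Ω) {ψ : E3 → ℝ} (hψ : ContDiff ℝ ∞ ψ)
    (hc : HasCompactSupport ψ) : MemLp (gradV (𝕜 := 𝕜) ψ) 2 (surfaceMeasure Ω) := by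
  have := isLocallyFiniteMeasure_surfaceMeasure hΩ
  refine (continuous_gradV hψ).memLp_of_hasCompactSupport ?_
  exact HasCompactSupport.intro hc.isCompact fun ζ hζ => gradV_eq_zero hζ

theorem memLp_ofReal (hΩ : IsStrongLipschitzDomain Ω) {ψ : E3 → ℝ} (hψ : ContDiff ℝ ∞ ψ)
    (hc : HasCompactSupport ψ) : MemLp (fun ζ => (ψ ζ : 𝕜)) 2 (surfaceMeasure Ω) := by
  have := isLocallyFiniteMeasure_surfaceMeasure hΩ
  exact (hψ.continuous.memLp_of_hasCompactSupport hc).ofReal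

/-! ### Weak tangential gradients with real test functions -/

variable (Ω) in
/-- The weak formulation `∫ ψ (ν × q) = - ∫ f (ν × ∇ψ)` for one test function `ψ`. -/
def TangGradTest (f : E3 → 𝕜) (q : E3 → V3 𝕜) (ψ : E3 → ℝ) : Prop :=
  ∀ i, ∫ ζ, (ψ ζ : 𝕜) * crossV (normal Ω ζ) (q ζ) i ∂surfaceMeasure Ω
    = -∫ ζ, f ζ * crossV (normal Ω ζ) (gradV ψ ζ) i ∂surfaceMeasure Ω

variable (Ω) in
/-- `q` is a weak tangential gradient of `f` on `O`, tested with real functions. -/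
def HasTangGradOn (O : Set E3) (f : E3 → 𝕜) (q : E3 → V3 𝕜) : Prop :=
  ∀ ψ : E3 → ℝ, ContDiff ℝ ∞ ψ → HasCompactSupport ψ → tsupport ψ ⊆ O → TangGradTest Ω f q ψ

theorem HasTangGradOn.mono {O O' : Set E3} {f : E3 → 𝕜} {q : E3 → V3 𝕜}
    (h : HasTangGradOn Ω O f q) (hO : O' ⊆ O) : HasTangGradOn Ω O' f q :=
  fun ψ h1 h2 h3 => h ψ h1 h2 (h3.trans hO)

theorem integrable_mul_crossV (hΩ : IsStrongLipschitzDomain Ω) {f : E3 → 𝕜} {q : E3 → V3 𝕜}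
    (hf : MemLp f 2 (surfaceMeasure Ω)) (hq : MemLp q 2 (surfaceMeasure Ω)) (i : Fin 3) :
    Integrable (fun ζ => f ζ * crossV (normal Ω ζ) (q ζ) i) (surfaceMeasure Ω) :=
  hf.integrable_mul (memLp_crossV_normal hΩ hq i)

theorem TangGradTest.add (hΩ : IsStrongLipschitzDomain Ω) {f : E3 → 𝕜} {q : E3 → V3 𝕜}
    (hf : MemLp f 2 (surfaceMeasure Ω)) (hq : MemLp q 2 (surfaceMeasure Ω)) {ψ χ : E3 → ℝ}
    (hψ : ContDiff ℝ ∞ ψ) (hcψ : HasCompactSupport ψ) (hχ : ContDiff ℝ ∞ χ)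
    (hcχ : HasCompactSupport χ) (h1 : TangGradTest Ω f q ψ) (h2 : TangGradTest Ω f q χ) :
    TangGradTest Ω f q (ψ + χ) := by
  intro i
  have hg (ζ : E3) : gradV (𝕜 := 𝕜) (ψ + χ) ζ = gradV ψ ζ + gradV χ ζ := by
    ext j
    simp [gradV, fderiv_add (hψ.differentiable (by simp) ζ) (hχ.differentiable (by simp) ζ)]
  simp only [hg, crossV_add, Pi.add_apply, RCLike.ofReal_add, add_mul, mul_add]
  rw [integral_add (integrable_mul_crossV hΩ (memLp_ofReal hΩ hψ hcψ) hq i)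
      (integrable_mul_crossV hΩ (memLp_ofReal hΩ hχ hcχ) hq i),
    integral_add (integrable_mul_crossV hΩ hf (memLp_gradV hΩ hψ hcψ) i)
      (integrable_mul_crossV hΩ hf (memLp_gradV hΩ hχ hcχ) i), h1 i, h2 i]
  ring

theorem hasTangGradOn_compl_frontier (f : E3 → 𝕜) (q : E3 → V3 𝕜) :
    HasTangGradOn Ω (frontier Ω)ᶜ f q := by
  intro ψ _ _ hs i
  have hn (ζ : E3) (hζ : ζ ∈ frontier Ω) : ζ ∉ tsupport ψ := fun h => hs h hζ
  rw [integral_eq_zero_of_ae, integral_eq_zero_of_ae, neg_zero]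
  · filter_upwards [ae_mem_frontier] with ζ hζ
    simp [gradV_eq_zero (hn ζ hζ)]
  · filter_upwards [ae_mem_frontier] with ζ hζ
    simp [image_eq_zero_of_notMem_tsupport (hn ζ hζ)]

open scoped Manifold in
/-- Weak tangential gradients are a local notion. -/
theorem hasTangGradOn_univ (hΩ : IsStrongLipschitzDomain Ω) {f : E3 → 𝕜} {q : E3 → V3 𝕜}
    (hf : MemLp f 2 (surfaceMeasure Ω)) (hq : MemLp q 2 (surfaceMeasure Ω))
    (h : ∀ k : Chart Ω, HasTangGradOn Ω k.cyl f q) : HasTangGradOn Ω univ f q := by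
  intro ψ hψ hc _
  -- The complement of `∂Ω` joins the cylinders, so that the partition of unity sums to one on all
  -- of space; test functions supported there contribute nothing to either side.
  let O : Option (Chart Ω) → Set E3 := fun o => o.elim (frontier Ω)ᶜ Chart.cyl
  have hO : ∀ o, IsOpen (O o) := by
    rintro (_ | k)
    · exact isClosed_frontier.isOpen_compl
    · exact k.isOpen_cyl
  have hcov : univ ⊆ ⋃ o, O o := by
    intro ζ _
    by_cases hζ : ζ ∈ frontier Ω
    · obtain ⟨k, hk⟩ := exists_chart hΩ hζ
      exact mem_iUnion.2 ⟨some k, k.dom_subset_cyl hk⟩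
    · exact mem_iUnion.2 ⟨none, hζ⟩
  have hT : ∀ o, HasTangGradOn Ω (O o) f q := by
    rintro (_ | k)
    · exact hasTangGradOn_compl_frontier f q
    · exact h k
  obtain ⟨ρ, hρ⟩ := SmoothPartitionOfUnity.exists_isSubordinate 𝓘(ℝ, E3) isClosed_univ O hO hcov
  have hρs (o : Option (Chart Ω)) : ContDiff ℝ ∞ (ρ o) := (ρ o).contMDiff.contDiff
  have hfin := ρ.locallyFinite.finite_nonempty_inter_compact hc.isCompact
  have hsum : ψ = ∑ o ∈ hfin.toFinset, fun ζ => ρ o ζ * ψ ζ := by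
    funext ζ
    rw [Finset.sum_apply, ← Finset.sum_mul]
    by_cases hζ : ζ ∈ tsupport ψ
    · have h1 := ρ.sum_eq_one (mem_univ ζ)
      rw [finsum_eq_sum_of_support_subset (s := hfin.toFinset)] at h1
      · rw [h1, one_mul]
      · intro o ho
        simp only [Finite.coe_toFinset]
        exact ⟨ζ, ho, hζ⟩
    · rw [image_eq_zero_of_notMem_tsupport hζ, mul_zero]
  have key : ∀ s : Finset (Option (Chart Ω)),
      ContDiff ℝ ∞ (∑ o ∈ s, fun ζ => ρ o ζ * ψ ζ) ∧
      HasCompactSupport (∑ o ∈ s, fun ζ => ρ o ζ * ψ ζ) ∧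
      TangGradTest Ω f q (∑ o ∈ s, fun ζ => ρ o ζ * ψ ζ) := by
    classical
    intro s
    induction s using Finset.induction_on with
    | empty =>
      refine ⟨contDiff_const, HasCompactSupport.zero, fun i => ?_⟩
      have h0 (ζ : E3) : gradV (𝕜 := 𝕜) (0 : E3 → ℝ) ζ = 0 := by
        ext j; simp [gradV]
      simp [h0]
    | insert o s ho ih =>
      have c1 : ContDiff ℝ ∞ fun ζ => ρ o ζ * ψ ζ := (hρs o).mul hψ
      have c2 : HasCompactSupport fun ζ => ρ o ζ * ψ ζ := hc.mul_left
      have c3 : TangGradTest Ω f q fun ζ => ρ o ζ * ψ ζ :=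
        hT o _ c1 c2 ((tsupport_mul_subset_left).trans (hρ o))
      rw [Finset.sum_insert ho]
      exact ⟨c1.add ih.1, c2.add ih.2.1, TangGradTest.add hΩ hf hq c1 c2 ih.1 ih.2.1 c3 ih.2.2⟩
  rw [hsum]
  exact (key _).2.2

theorem ae_sum_sq_normal (hΩ : IsStrongLipschitzDomain Ω) : ∀ᵐ ζ ∂surfaceMeasure Ω,
    normal Ω ζ 0 ^ 2 + normal Ω ζ 1 ^ 2 + normal Ω ζ 2 ^ 2 = 1 :=
  ae_of_forall_chart fun k => (k.ae_normal_coord hΩ).mono fun ζ h => by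
    rw [h]; exact k.sum_sq_normal _

/-- Tangential weak tangential gradients are unique. -/
theorem HasTangGradOn.ae_unique (hΩ : IsStrongLipschitzDomain Ω) {O : Set E3} (hO : IsOpen O)
    {f : E3 → 𝕜} {q r : E3 → V3 𝕜}
    (hq : MemLp q 2 (surfaceMeasure Ω)) (hr : MemLp r 2 (surfaceMeasure Ω))
    (hqt : ∀ᵐ ζ ∂surfaceMeasure Ω, dotV (normal Ω ζ) (q ζ) = 0)
    (hrt : ∀ᵐ ζ ∂surfaceMeasure Ω, dotV (normal Ω ζ) (r ζ) = 0)
    (h1 : HasTangGradOn Ω O f q) (h2 : HasTangGradOn Ω O f r) :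
    ∀ᵐ ζ ∂surfaceMeasure Ω, ζ ∈ O → q ζ = r ζ := by
  have := isLocallyFiniteMeasure_surfaceMeasure hΩ
  have hz : ∀ i : Fin 3, ∀ᵐ ζ ∂surfaceMeasure Ω, ζ ∈ O →
      crossV (normal Ω ζ) (q ζ - r ζ) i = 0 := by
    intro i
    refine hO.ae_eq_zero_of_integral_contDiff_smul_eq_zero
      (((memLp_crossV_normal hΩ (hq.sub hr) i).locallyIntegrable
        (by norm_num)).locallyIntegrableOn O) fun ψ hψ hc hs => ?_
    have e := (h1 ψ hψ hc hs i).trans (h2 ψ hψ hc hs i).symm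
    simp only [RCLike.real_smul_eq_coe_mul, crossV_sub, mul_sub]
    rw [integral_sub (integrable_mul_crossV hΩ (memLp_ofReal hΩ hψ hc) hq i)
      (integrable_mul_crossV hΩ (memLp_ofReal hΩ hψ hc) hr i), e, sub_self]
  filter_upwards [ae_all_iff.2 hz, hqt, hrt, ae_sum_sq_normal hΩ] with ζ h3 h4 h5 h6 hζ
  refine sub_eq_zero.1 (eq_zero_of_crossV_eq_zero h6 ?_ fun i => h3 i hζ)
  have : dotV (normal Ω ζ) (q ζ - r ζ) = dotV (normal Ω ζ) (q ζ) - dotV (normal Ω ζ) (r ζ) := by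
    simp only [dotV, Fin.sum_univ_three, PiLp.sub_apply]
    ring
  rw [this, h4, h5, sub_self]

/-! ### Equivalence with the formulation by vector fields -/

theorem inner_crossV (n : E3) (q z : V3 𝕜) :
    inner 𝕜 q (crossV n z) = -∑ i, z i * (starRingEnd 𝕜) (crossV n q i) := by
  simp [PiLp.inner_apply, crossV, crossProduct, Fin.sum_univ_three]
  ring

/-- The triple product identity `n · (∇ × Φ) = Σᵢ (n × ∇Φᵢ)ᵢ` separates the components of `Φ` and so
reduces fields to scalar test functions. -/
theorem dotV_rot (n : E3) (Φ : E3 → V3 𝕜) (ζ : E3) :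
    dotV n (rot Φ ζ) = ∑ i, crossV n (WithLp.toLp 2 fun j => fderiv ℝ Φ ζ (e3 j) i) i := by
  simp [dotV, rot, crossV, crossProduct, Fin.sum_univ_three]
  ring

theorem conj_crossV_gradV (n : E3) (ψ : E3 → ℝ) (ζ : E3) (i : Fin 3) :
    (starRingEnd 𝕜) (crossV n (gradV ψ ζ) i) = crossV n (gradV ψ ζ) i := by
  fin_cases i <;> simp [crossV, crossProduct, gradV]

/-- In the field formulation `f` and `q` sit in the conjugate-linear slot; since `ψ` and `ν` are
real, conjugation falls only on them. -/
theorem TangGradTest.conj {f : E3 → 𝕜} {q : E3 → V3 𝕜} {ψ : E3 → ℝ} (h : TangGradTest Ω f q ψ)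
    (i : Fin 3) :
    ∫ ζ, (ψ ζ : 𝕜) * (starRingEnd 𝕜) (crossV (normal Ω ζ) (q ζ) i) ∂surfaceMeasure Ω
      = -∫ ζ, (starRingEnd 𝕜) (f ζ) * crossV (normal Ω ζ) (gradV ψ ζ) i ∂surfaceMeasure Ω := by
  have := congrArg (starRingEnd 𝕜) (h i)
  rw [map_neg, ← integral_conj, ← integral_conj] at this
  simpa only [map_mul, RCLike.conj_ofReal, conj_crossV_gradV] using this

theorem hasTangGradOn_of_forall_field {f : E3 → 𝕜} {q : E3 → V3 𝕜}
    (h : ∀ Φ : E3 → V3 𝕜, ContDiff ℝ ∞ Φ → HasCompactSupport Φ →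
      ∫ ζ, inner 𝕜 (q ζ) (crossV (normal Ω ζ) (Φ ζ)) ∂(surfaceMeasure Ω)
        = ∫ ζ, inner 𝕜 (f ζ) (dotV (normal Ω ζ) (rot Φ ζ)) ∂(surfaceMeasure Ω)) :
    HasTangGradOn Ω univ f q := by
  intro ψ hψ hc _ i
  -- The field `Φ = ψ eᵢ` isolates the `i`-th component.
  have hs : ContDiff ℝ ∞ fun ζ => ψ ζ • (EuclideanSpace.single i 1 : V3 𝕜) :=
    hψ.smul contDiff_const
  have e := h _ hs hc.smul_right
  have e1 (ζ : E3) : inner 𝕜 (q ζ)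
      (crossV (normal Ω ζ) (ψ ζ • (EuclideanSpace.single i 1 : V3 𝕜)))
      = (starRingEnd 𝕜) (-((ψ ζ : 𝕜) * crossV (normal Ω ζ) (q ζ) i)) := by
    rw [inner_crossV, Finset.sum_eq_single i]
    · simp [RCLike.real_smul_eq_coe_mul]
    · intro j _ hj
      simp [hj]
    · simp
  have e2 (ζ : E3) : inner 𝕜 (f ζ) (dotV (normal Ω ζ)
      (rot (fun ζ => ψ ζ • (EuclideanSpace.single i 1 : V3 𝕜)) ζ))
      = (starRingEnd 𝕜) (f ζ * crossV (normal Ω ζ) (gradV ψ ζ) i) := by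
    have hd (a j : Fin 3) : fderiv ℝ (fun ζ => ψ ζ • (EuclideanSpace.single i 1 : V3 𝕜)) ζ (e3 a) j
        = if j = i then ((fderiv ℝ ψ ζ (e3 a) : ℝ) : 𝕜) else 0 := by
      rw [fderiv_smul_const (hψ.differentiable (by simp) ζ)]
      by_cases hj : j = i <;> simp [hj, RCLike.real_smul_eq_coe_mul]
    rw [map_mul, conj_crossV_gradV, dotV_rot, Finset.sum_eq_single i]
    · simp only [hd, if_true]
      simp [gradV, mul_comm]
    · intro j _ hj
      simp only [hd, if_neg hj]
      exact crossV_zero _ _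
    · simp
  simp only [e1, e2] at e
  rw [integral_conj, integral_conj] at e
  have := (starRingEnd 𝕜).injective e
  rw [integral_neg] at this
  rw [← this, neg_neg]

theorem integral_field_eq (hΩ : IsStrongLipschitzDomain Ω) {f : E3 → 𝕜} {q : E3 → V3 𝕜}
    (hf : MemLp f 2 (surfaceMeasure Ω)) (hq : MemLp q 2 (surfaceMeasure Ω))
    (h : HasTangGradOn Ω univ f q) {Φ : E3 → V3 𝕜} (hΦ : ContDiff ℝ ∞ Φ)
    (hc : HasCompactSupport Φ) :
    ∫ ζ, inner 𝕜 (q ζ) (crossV (normal Ω ζ) (Φ ζ)) ∂(surfaceMeasure Ω)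
      = ∫ ζ, inner 𝕜 (f ζ) (dotV (normal Ω ζ) (rot Φ ζ)) ∂(surfaceMeasure Ω) := by
  have hcomp (i : Fin 3) : ContDiff ℝ ∞ fun ζ => Φ ζ i :=
    ((EuclideanSpace.proj (𝕜 := 𝕜) i : V3 𝕜 →L[𝕜] 𝕜).restrictScalars ℝ).contDiff.comp hΦ
  have hcc (i : Fin 3) : HasCompactSupport fun ζ => Φ ζ i :=
    hc.comp_left (g := fun z : V3 𝕜 => z i) rfl
  -- Real and imaginary parts of the components are the real test functions; the two sides are
  -- linear in `Φ`.
  let R (i : Fin 3) (ζ : E3) : ℝ := RCLike.re (Φ ζ i)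
  let S (i : Fin 3) (ζ : E3) : ℝ := RCLike.im (Φ ζ i)
  have hR (i : Fin 3) : ContDiff ℝ ∞ (R i) := (RCLike.reCLM (K := 𝕜)).contDiff.comp (hcomp i)
  have hS (i : Fin 3) : ContDiff ℝ ∞ (S i) := (RCLike.imCLM (K := 𝕜)).contDiff.comp (hcomp i)
  have hRc (i : Fin 3) : HasCompactSupport (R i) :=
    (hcc i).comp_left (g := fun z : 𝕜 => RCLike.re z) (by simp)
  have hSc (i : Fin 3) : HasCompactSupport (S i) :=
    (hcc i).comp_left (g := fun z : 𝕜 => RCLike.im z) (by simp)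
  have hdec (i : Fin 3) (ζ : E3) : Φ ζ i = (R i ζ : 𝕜) + RCLike.I * (S i ζ : 𝕜) := by
    rw [mul_comm]; exact (RCLike.re_add_im _).symm
  have hD (i j : Fin 3) (ζ : E3) : fderiv ℝ Φ ζ (e3 j) i
      = ((fderiv ℝ (R i) ζ (e3 j) : ℝ) : 𝕜)
        + RCLike.I * ((fderiv ℝ (S i) ζ (e3 j) : ℝ) : 𝕜) := by
    have hd : DifferentiableAt ℝ Φ ζ := hΦ.differentiable (by simp) ζ
    have hp : HasFDerivAt (fun ζ => Φ ζ i)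
        (((EuclideanSpace.proj (𝕜 := 𝕜) i : V3 𝕜 →L[𝕜] 𝕜).restrictScalars ℝ).comp
          (fderiv ℝ Φ ζ)) ζ :=
      ((EuclideanSpace.proj (𝕜 := 𝕜) i : V3 𝕜 →L[𝕜] 𝕜).restrictScalars ℝ).hasFDerivAt.comp ζ
        hd.hasFDerivAt
    have h1 : HasFDerivAt (R i) _ ζ := (RCLike.reCLM (K := 𝕜)).hasFDerivAt.comp ζ hp
    have h2 : HasFDerivAt (S i) _ ζ := (RCLike.imCLM (K := 𝕜)).hasFDerivAt.comp ζ hp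
    rw [h1.fderiv, h2.fderiv, mul_comm]
    exact (RCLike.re_add_im _).symm
  have hcr (i : Fin 3) (ζ : E3) :
      crossV (normal Ω ζ) (WithLp.toLp 2 fun j => fderiv ℝ Φ ζ (e3 j) i) i
        = crossV (normal Ω ζ) (gradV (R i) ζ) i
          + RCLike.I * crossV (normal Ω ζ) (gradV (S i) ζ) i := by
    simp only [hD]
    fin_cases i <;> simp [crossV, crossProduct, gradV] <;> ring
  have hTR (i : Fin 3) := (h (R i) (hR i) (hRc i) (subset_univ _)).conj i
  have hTS (i : Fin 3) := (h (S i) (hS i) (hSc i) (subset_univ _)).conj i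
  have hqc (i : Fin 3) : MemLp (fun ζ => (starRingEnd 𝕜) (crossV (normal Ω ζ) (q ζ) i)) 2
      (surfaceMeasure Ω) := (memLp_crossV_normal hΩ hq i).star
  have hfc : MemLp (fun ζ => (starRingEnd 𝕜) (f ζ)) 2 (surfaceMeasure Ω) := hf.star
  have I1 (i : Fin 3) : Integrable (fun ζ => (R i ζ : 𝕜) *
      (starRingEnd 𝕜) (crossV (normal Ω ζ) (q ζ) i)) (surfaceMeasure Ω) :=
    (memLp_ofReal hΩ (hR i) (hRc i)).integrable_mul (hqc i)
  have I2 (i : Fin 3) : Integrable (fun ζ => (S i ζ : 𝕜) *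
      (starRingEnd 𝕜) (crossV (normal Ω ζ) (q ζ) i)) (surfaceMeasure Ω) :=
    (memLp_ofReal hΩ (hS i) (hSc i)).integrable_mul (hqc i)
  have J1 (i : Fin 3) := integrable_mul_crossV hΩ hfc (memLp_gradV (𝕜 := 𝕜) hΩ (hR i) (hRc i)) i
  have J2 (i : Fin 3) := integrable_mul_crossV hΩ hfc (memLp_gradV (𝕜 := 𝕜) hΩ (hS i) (hSc i)) i
  have hl (ζ : E3) : inner 𝕜 (q ζ) (crossV (normal Ω ζ) (Φ ζ))
      = -∑ i, ((R i ζ : 𝕜) * (starRingEnd 𝕜) (crossV (normal Ω ζ) (q ζ) i)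
        + RCLike.I * ((S i ζ : 𝕜) * (starRingEnd 𝕜) (crossV (normal Ω ζ) (q ζ) i))) := by
    rw [inner_crossV]
    congr 1
    refine Finset.sum_congr rfl fun i _ => ?_
    rw [hdec]
    ring
  have hr (ζ : E3) : inner 𝕜 (f ζ) (dotV (normal Ω ζ) (rot Φ ζ))
      = ∑ i, ((starRingEnd 𝕜) (f ζ) * crossV (normal Ω ζ) (gradV (R i) ζ) i
        + RCLike.I * ((starRingEnd 𝕜) (f ζ) * crossV (normal Ω ζ) (gradV (S i) ζ) i)) := by
    rw [dotV_rot, RCLike.inner_apply, Finset.sum_mul]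
    refine Finset.sum_congr rfl fun i _ => ?_
    rw [hcr]
    ring
  have K1 (i : Fin 3) : Integrable (fun ζ => (R i ζ : 𝕜) *
      (starRingEnd 𝕜) (crossV (normal Ω ζ) (q ζ) i) + RCLike.I * ((S i ζ : 𝕜) *
      (starRingEnd 𝕜) (crossV (normal Ω ζ) (q ζ) i))) (surfaceMeasure Ω) :=
    (I1 i).add ((I2 i).const_mul _)
  have K2 (i : Fin 3) : Integrable (fun ζ => (starRingEnd 𝕜) (f ζ) *
      crossV (normal Ω ζ) (gradV (R i) ζ) i + RCLike.I * ((starRingEnd 𝕜) (f ζ) *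
      crossV (normal Ω ζ) (gradV (S i) ζ) i)) (surfaceMeasure Ω) :=
    (J1 i).add ((J2 i).const_mul _)
  simp only [hl, hr]
  rw [integral_neg, integral_finsetSum _ fun i _ => K1 i, integral_finsetSum _ fun i _ => K2 i,
    ← Finset.sum_neg_distrib]
  refine Finset.sum_congr rfl fun i _ => ?_
  rw [integral_add (I1 i) ((I2 i).const_mul _), integral_add (J1 i) ((J2 i).const_mul _),
    integral_const_mul, integral_const_mul, hTR i, hTS i]
  ring

end WeakForm

section LocalForm

variable {𝕜 : Type*} [RCLike 𝕜] {Ω : Set E3}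

/-! ### Weak tangential gradients in a chart -/

namespace Chart

variable (k : Chart Ω)

theorem fderiv_comp_inv {x : E2} (h : DifferentiableAt ℝ k.patch.a x) {ψ : E3 → ℝ}
    (hψ : ContDiff ℝ ∞ ψ) (j : Fin 2) :
    fderiv ℝ (fun y => ψ (k.inv y)) x (e2 j) = ∑ i, k.jac x i j * fderiv ℝ ψ (k.inv x) (e3 i) := by
  have h1 : DifferentiableAt ℝ k.inv x := (k.hasFDerivAt_inv h).differentiableAt
  have h2 : HasFDerivAt ψ (fderiv ℝ ψ (k.inv x)) (k.inv x) :=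
    (hψ.differentiable (by simp) _).hasFDerivAt
  have h3 : HasFDerivAt (fun y => ψ (k.inv y)) _ x := h2.comp x h1.hasFDerivAt
  have e : fderiv ℝ k.inv x (e2 j) = ∑ i, k.jac x i j • e3 i := by
    ext i
    fin_cases i <;> simp [jac, e3, Fin.sum_univ_three]
  rw [h3.fderiv, ContinuousLinearMap.comp_apply, e, map_sum]
  simp only [map_smul, smul_eq_mul]

theorem cov_gradV {x : E2} (h : DifferentiableAt ℝ k.patch.a x) {ψ : E3 → ℝ}
    (hψ : ContDiff ℝ ∞ ψ) (j : Fin 2) :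
    k.cov x (gradV (𝕜 := 𝕜) ψ (k.inv x)) j
      = ((fderiv ℝ (fun y => ψ (k.inv y)) x (e2 j) : ℝ) : 𝕜) := by
  rw [k.fderiv_comp_inv h hψ]
  simp [cov, gradV]

/-- The weak formulation on the cylinder of a chart, in the coordinates of the chart. -/
theorem tangGradTest_iff (hΩ : IsStrongLipschitzDomain Ω) {f : E3 → 𝕜} {q : E3 → V3 𝕜}
    (hf : AEStronglyMeasurable f (surfaceMeasure Ω))
    (hq : AEStronglyMeasurable q (surfaceMeasure Ω)) {ψ : E3 → ℝ} (hψ : ContDiff ℝ ∞ ψ)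
    (hs : tsupport ψ ⊆ k.cyl) : TangGradTest Ω f q ψ ↔ ∀ i,
      ∫ x in k.U, (ψ (k.inv x) : 𝕜) * ((k.jac x i 1 : 𝕜) * k.cov x (q (k.inv x)) 0
        - (k.jac x i 0 : 𝕜) * k.cov x (q (k.inv x)) 1)
      = -∫ x in k.U, ((fderiv ℝ (fun y => ψ (k.inv y)) x (e2 0) * k.jac x i 1
        - fderiv ℝ (fun y => ψ (k.inv y)) x (e2 1) * k.jac x i 0 : ℝ) : 𝕜) * f (k.inv x) := by
  obtain ⟨δ, hδ, hcross⟩ := k.exists_area_mul_crossV (𝕜 := 𝕜)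
  -- The orientation factor multiplies both sides and cancels at the end.
  have hδ' : (δ : 𝕜) ≠ 0 := by simpa using hδ
  refine forall_congr' fun i => ?_
  have hg : AEStronglyMeasurable (gradV (𝕜 := 𝕜) ψ) (surfaceMeasure Ω) :=
    (continuous_gradV hψ).aestronglyMeasurable
  have hψm : AEStronglyMeasurable (fun ζ => (ψ ζ : 𝕜)) (surfaceMeasure Ω) :=
    (RCLike.continuous_ofReal.comp hψ.continuous).aestronglyMeasurable
  have l : ∫ ζ, (ψ ζ : 𝕜) * crossV (LipBdry.normal Ω ζ) (q ζ) i ∂surfaceMeasure Ω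
      = δ * ∫ x in k.U, (ψ (k.inv x) : 𝕜) * ((k.jac x i 1 : 𝕜) * k.cov x (q (k.inv x)) 0
        - (k.jac x i 0 : 𝕜) * k.cov x (q (k.inv x)) 1) := by
    have hm : AEStronglyMeasurable
        (fun ζ => (ψ ζ : 𝕜) * crossV (LipBdry.normal Ω ζ) (q ζ) i) (surfaceMeasure Ω) :=
      hψm.mul (aestronglyMeasurable_crossV_normal hΩ hq i)
    rw [k.integral_surfaceMeasure hΩ hm, ← integral_const_mul]
    · refine integral_congr_ae ?_
      filter_upwards [k.ae_differentiableAt, k.ae_normal_inv hΩ] with x h hn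
      simp only [hn, RCLike.real_smul_eq_coe_mul]
      linear_combination (ψ (k.inv x) : 𝕜) * hcross x h (q (k.inv x)) i
    · intro ζ hζ
      rw [image_eq_zero_of_notMem_tsupport fun h => hζ (hs h)]
      simp
  have r : ∫ ζ, f ζ * crossV (LipBdry.normal Ω ζ) (gradV ψ ζ) i ∂surfaceMeasure Ω
      = δ * ∫ x in k.U, ((fderiv ℝ (fun y => ψ (k.inv y)) x (e2 0) * k.jac x i 1
        - fderiv ℝ (fun y => ψ (k.inv y)) x (e2 1) * k.jac x i 0 : ℝ) : 𝕜) * f (k.inv x) := by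
    have hm : AEStronglyMeasurable
        (fun ζ => f ζ * crossV (LipBdry.normal Ω ζ) (gradV ψ ζ) i) (surfaceMeasure Ω) :=
      hf.mul (aestronglyMeasurable_crossV_normal hΩ hg i)
    rw [k.integral_surfaceMeasure hΩ hm, ← integral_const_mul]
    · refine integral_congr_ae ?_
      filter_upwards [k.ae_differentiableAt, k.ae_normal_inv hΩ] with x h hn
      have := hcross x h (gradV ψ (k.inv x)) i
      rw [k.cov_gradV h hψ, k.cov_gradV h hψ] at this
      simp only [hn, RCLike.real_smul_eq_coe_mul]
      push_cast
      linear_combination f (k.inv x) * this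
    · intro ζ hζ
      rw [gradV_eq_zero fun h => hζ (hs h)]
      simp
  rw [l, r, ← mul_neg, mul_right_inj' hδ']

theorem integrable_of_memLp {E : Type*} [NormedAddCommGroup E] {u : E2 → E}
    (hu : MemLp u 2 (volume.restrict k.U)) : Integrable u (volume.restrict k.U) := by
  have : IsFiniteMeasure (volume.restrict k.U) :=
    ⟨by rw [Measure.restrict_apply_univ]; exact k.volume_U_lt_top⟩
  exact hu.integrable (by norm_num)

/-- A gradient in the sense of the chart is a weak tangential gradient on its cylinder. -/
theorem hasTangGradOn_cyl (hΩ : IsStrongLipschitzDomain Ω) {f : E3 → 𝕜} {q : E3 → V3 𝕜}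
    (hf : AEStronglyMeasurable f (surfaceMeasure Ω))
    (hq : AEStronglyMeasurable q (surfaceMeasure Ω)) {g : E2 → V2 𝕜}
    (hg : IsH1WithGrad k.U (fun x => f (k.inv x)) g)
    (hqg : ∀ᵐ x ∂(volume.restrict k.U), k.cov x (q (k.inv x)) = g x) :
    HasTangGradOn Ω k.cyl f q := by
  intro ψ hψ hc hs
  rw [k.tangGradTest_iff hΩ hf hq hψ hs]
  intro i
  obtain ⟨K, A, hA, hAa, hF⟩ := k.exists_ext_inv
  set F : E2 → E3 := fun x => k.p + x 0 • k.patch.w 0 + x 1 • k.patch.w 1 + A x • k.patch.v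
    with hFdef
  have hFc : Continuous F := by
    have := hA.continuous
    fun_prop
  have hcF (x : E2) : k.coord (F x) = x := k.coord_add x _
  have hproj (j : Fin 2) : LipschitzWith 1 fun x : E2 => x j :=
    LipschitzWith.of_dist_le_mul fun x y => by
      simpa [dist_eq_norm] using PiLp.norm_apply_le (x - y) j
  have hFL : ∃ L, LipschitzWith L F := by
    have hsm {a : E2 → ℝ} {M : ℝ≥0} (ha : LipschitzWith M a) (w : E3) :
        LipschitzWith (‖w‖₊ * M) fun x => a x • w :=
      LipschitzWith.of_dist_le_mul fun x y => by
        rw [dist_eq_norm, ← sub_smul, norm_smul, ← dist_eq_norm, NNReal.coe_mul, coe_nnnorm]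
        have := ha.dist_le_mul x y
        nlinarith [norm_nonneg w]
    exact ⟨_, (((LipschitzWith.const k.p).add (hsm (hproj 0) _)).add (hsm (hproj 1) _)).add
      (hsm hA _)⟩
  obtain ⟨L, hL⟩ := hFL
  have hFi : LipschitzWith L fun x => F x i :=
    LipschitzWith.of_dist_le_mul fun x y => by
      refine le_trans ?_ (hL.dist_le_mul x y)
      simpa [dist_eq_norm] using PiLp.norm_apply_le (F x - F y) i
  obtain ⟨M, hM⟩ := hψ.lipschitzWith_of_hasCompactSupport hc (by simp)
  have hψF : LipschitzWith (M * L) fun x => ψ (F x) := hM.comp hL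
  have hsupp : tsupport (fun x => ψ (F x)) ⊆ F ⁻¹' tsupport ψ :=
    tsupport_comp_subset_preimage ψ hFc
  have hsU : tsupport (fun x => ψ (F x)) ⊆ k.U := fun x hx => by
    simpa [hcF] using (hs (hsupp hx)).1
  have hcF' : HasCompactSupport fun x => ψ (F x) := by
    refine (hc.isCompact.image k.continuous_coord).of_isClosed_subset (isClosed_tsupport _) ?_
    exact fun x hx => ⟨F x, hsupp hx, hcF x⟩
  -- The Lipschitz function `A` of the Jacobian identity is the coordinate `Fᵢ` of the extended
  -- parametrisation, and the test function is `ψ ∘ F`.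
  have key := hg.2.2.integral_jacobian k.isOpen_U (k.integrable_of_memLp hg.1)
    (k.integrable_of_memLp hg.2.1) hFi hψF hcF' hsU
  have hev {x : E2} (hx : x ∈ k.U) : F =ᶠ[𝓝 x] k.inv := by
    filter_upwards [k.isOpen_U.mem_nhds hx] with y hy
    exact (hF hy).symm
  have hdψ {x : E2} (hx : x ∈ k.U) (j : Fin 2) : fderiv ℝ (fun x => ψ (F x)) x (e2 j)
      = fderiv ℝ (fun x => ψ (k.inv x)) x (e2 j) := by
    rw [Filter.EventuallyEq.fderiv_eq]
    filter_upwards [hev hx] with y hy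
    rw [hy]
  have hdF {x : E2} (hx : x ∈ k.U) (h : DifferentiableAt ℝ k.patch.a x) (j : Fin 2) :
      fderiv ℝ (fun x => F x i) x (e2 j) = k.jac x i j := by
    have h1 : DifferentiableAt ℝ k.inv x := (k.hasFDerivAt_inv h).differentiableAt
    have h2 : HasFDerivAt (fun y => k.inv y i)
        ((EuclideanSpace.proj i : E3 →L[ℝ] ℝ).comp (fderiv ℝ k.inv x)) x :=
      (EuclideanSpace.proj i : E3 →L[ℝ] ℝ).hasFDerivAt.comp x h1.hasFDerivAt
    have h3 : (fun x => F x i) =ᶠ[𝓝 x] fun y => k.inv y i := by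
      filter_upwards [hev hx] with y hy
      rw [hy]
    rw [h3.fderiv_eq, h2.fderiv]
    rfl
  have hUm := ae_restrict_mem (μ := volume) k.isOpen_U.measurableSet
  have e1 : ∫ x in k.U, (ψ (k.inv x) : 𝕜) * ((k.jac x i 1 : 𝕜) * k.cov x (q (k.inv x)) 0
        - (k.jac x i 0 : 𝕜) * k.cov x (q (k.inv x)) 1)
      = ∫ x in k.U, (((ψ (F x) * fderiv ℝ (fun x => F x i) x (e2 1) : ℝ) : 𝕜) * g x 0
        - ((ψ (F x) * fderiv ℝ (fun x => F x i) x (e2 0) : ℝ) : 𝕜) * g x 1) := by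
    refine integral_congr_ae ?_
    filter_upwards [k.ae_differentiableAt, hUm, hqg] with x h hx hgx
    simp only [hdF hx h, hgx, ← hF hx]
    push_cast
    ring
  have e2 : ∫ x in k.U, ((fderiv ℝ (fun y => ψ (k.inv y)) x (e2 0) * k.jac x i 1
        - fderiv ℝ (fun y => ψ (k.inv y)) x (e2 1) * k.jac x i 0 : ℝ) : 𝕜) * f (k.inv x)
      = ∫ x in k.U, ((fderiv ℝ (fun x => ψ (F x)) x (e2 0) * fderiv ℝ (fun x => F x i) x (e2 1)
        - fderiv ℝ (fun x => ψ (F x)) x (e2 1) * fderiv ℝ (fun x => F x i) x (e2 0) : ℝ) : 𝕜)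
          * f (k.inv x) := by
    refine integral_congr_ae ?_
    filter_upwards [k.ae_differentiableAt, hUm] with x h hx
    simp only [hdF hx h, hdψ hx]
  rw [e1, e2, key, neg_neg]

/-! ### From weak tangential gradients back to weak gradients in the plane. -/

theorem exists_jac_le : ∃ C : ℝ, ∀ x ∈ k.U, DifferentiableAt ℝ k.patch.a x →
    ∀ i j, |k.jac x i j| ≤ C := by
  obtain ⟨K, hK⟩ := k.exists_slope_le
  refine ⟨1 + K, fun x hx h i j => ?_⟩
  have hw : |k.patch.w j i| ≤ 1 := by
    have := PiLp.norm_apply_le (k.patch.w j) i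
    rwa [k.patch.orthonormal_w.1 j] at this
  have hv : |k.patch.v i| ≤ 1 := by
    have := PiLp.norm_apply_le k.patch.v i
    rwa [k.patch.norm_v] at this
  rw [k.jac_apply h]
  refine (abs_add_le _ _).trans (add_le_add hw ?_)
  rw [abs_mul]
  calc |k.slope x j| * |k.patch.v i| ≤ K * 1 :=
        mul_le_mul (hK x hx j) hv (abs_nonneg _) K.coe_nonneg
    _ = K := mul_one _

theorem memLp_cov {q : E2 → V3 𝕜} (hq : MemLp q 2 (volume.restrict k.U)) :
    MemLp (fun x => k.cov x (q x)) 2 (volume.restrict k.U) := by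
  obtain ⟨C, hC⟩ := k.exists_jac_le
  rw [memLp_piLp_iff]
  intro j
  suffices h : MemLp (fun x => ∑ i, (k.jac x i j : 𝕜) * q x i) 2 (volume.restrict k.U) from h
  refine memLp_finsetSum _ fun i _ => ?_
  have hqi : MemLp (fun x => q x i) 2 (volume.restrict k.U) := (memLp_piLp_iff.1 hq) i
  have hm : AEStronglyMeasurable (fun x => (k.jac x i j : 𝕜)) (volume.restrict k.U) :=
    RCLike.continuous_ofReal.comp_aestronglyMeasurable (k.measurable_jac i j).aestronglyMeasurable
  refine hqi.of_le_mul (c := C) (hm.mul hqi.1) ?_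
  filter_upwards [k.ae_differentiableAt, ae_restrict_mem k.isOpen_U.measurableSet] with x h hx
  rw [norm_mul, RCLike.norm_ofReal]
  exact mul_le_mul_of_nonneg_right (hC x hx h i j) (norm_nonneg _)

/-- A test function on the cylinder that extends a test function of the parameters. -/
theorem exists_test_extension {φ : E2 → ℝ} (hφ : ContDiff ℝ ∞ φ) (hc : HasCompactSupport φ)
    (hs : tsupport φ ⊆ k.U) : ∃ ψ : E3 → ℝ, ContDiff ℝ ∞ ψ ∧ HasCompactSupport ψ ∧
      tsupport ψ ⊆ k.cyl ∧ ∀ x ∈ k.U, ψ (k.inv x) = φ x := by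
  have hh := k.patch.h_pos
  -- The cutoff in the height equals `1` up to `h/2`, hence on the graph because `|a| < h/2`, and
  -- vanishes beyond `3h/4 < h`, inside the cylinder.
  let χ : ContDiffBump (0 : ℝ) :=
    ⟨k.patch.h / 2, 3 * k.patch.h / 4, by linarith, by linarith⟩
  have hin : ContDiff ℝ ∞ fun z : E3 => inner ℝ k.patch.v (z - k.p) :=
    contDiff_const.inner ℝ (contDiff_id.sub contDiff_const)
  let ψ : E3 → ℝ := fun z => φ (k.coord z) * χ (inner ℝ k.patch.v (z - k.p))
  have hsub : tsupport ψ ⊆ {z | k.coord z ∈ tsupport φ ∧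
      inner ℝ k.patch.v (z - k.p) ∈ Icc (-(3 * k.patch.h / 4)) (3 * k.patch.h / 4)} := by
    refine closure_minimal (fun z hz => ?_) ?_
    · have hz' : φ (k.coord z) * χ (inner ℝ k.patch.v (z - k.p)) ≠ 0 := hz
      refine ⟨subset_tsupport _ (left_ne_zero_of_mul hz'), ?_⟩
      have h2 : inner ℝ k.patch.v (z - k.p) ∈ Function.support χ := right_ne_zero_of_mul hz'
      rw [χ.support_eq, mem_ball_zero_iff, Real.norm_eq_abs] at h2
      exact abs_le.1 (le_of_lt h2)
    · exact ((isClosed_tsupport φ).preimage k.continuous_coord).inter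
        (isClosed_Icc.preimage hin.continuous)
  refine ⟨ψ, (hφ.comp k.contDiff_coord).mul (χ.contDiff.comp hin), ?_, ?_, fun x hx => ?_⟩
  · have hcont : Continuous fun y : E2 × ℝ =>
        k.p + y.1 0 • k.patch.w 0 + y.1 1 • k.patch.w 1 + y.2 • k.patch.v := by fun_prop
    refine ((hc.isCompact.prod (isCompact_Icc
      (a := -(3 * k.patch.h / 4)) (b := 3 * k.patch.h / 4))).image hcont).of_isClosed_subset
      (isClosed_tsupport _) fun z hz => ?_
    exact ⟨(k.coord z, inner ℝ k.patch.v (z - k.p)), hsub hz, k.expand_coord z⟩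
  · intro z hz
    obtain ⟨h1, h2, h3⟩ := hsub hz
    exact ⟨hs h1, by linarith, by linarith⟩
  · have h1 : χ (k.patch.a x) = 1 := by
      refine χ.one_of_mem_closedBall ?_
      rw [mem_closedBall_zero_iff, Real.norm_eq_abs]
      exact (k.abs_a_lt hx).le
    simp [ψ, h1]

/-- A weak tangential gradient on the cylinder of a chart is a gradient in the sense of the
chart. -/
theorem isH1WithGrad_of_hasTangGradOn (hΩ : IsStrongLipschitzDomain Ω) {f : E3 → 𝕜}
    {q : E3 → V3 𝕜} (hf : MemLp f 2 (surfaceMeasure Ω)) (hq : MemLp q 2 (surfaceMeasure Ω))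
    (h : HasTangGradOn Ω k.cyl f q) :
    IsH1WithGrad k.U (fun x => f (k.inv x)) (fun x => k.cov x (q (k.inv x))) := by
  have hfU := k.memLp_comp_inv hΩ hf
  have hgU := k.memLp_cov (k.memLp_comp_inv hΩ hq)
  refine ⟨hfU, hgU, fun φ hφ hc hs => ?_⟩
  obtain ⟨ψ, hψ, hψc, hψs, hψφ⟩ := k.exists_test_extension hφ hc hs
  have key := (k.tangGradTest_iff hΩ hf.1 hq.1 hψ hψs).1 (h ψ hψ hψc hψs)
  have hUm := ae_restrict_mem (μ := volume) k.isOpen_U.measurableSet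
  have hdφ {x : E2} (hx : x ∈ k.U) (j : Fin 2) :
      fderiv ℝ (fun y => ψ (k.inv y)) x (e2 j) = fderiv ℝ φ x (e2 j) := by
    rw [Filter.EventuallyEq.fderiv_eq]
    filter_upwards [k.isOpen_U.mem_nhds hx] with y hy
    exact hψφ y hy
  obtain ⟨C, hC⟩ := k.exists_jac_le
  have hjm (i : Fin 3) (j : Fin 2) : AEStronglyMeasurable (fun x => (k.jac x i j : 𝕜))
      (volume.restrict k.U) :=
    RCLike.continuous_ofReal.comp_aestronglyMeasurable (k.measurable_jac i j).aestronglyMeasurable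
  have hjb {u : E2 → 𝕜} (hu : Integrable u (volume.restrict k.U)) (i : Fin 3) (j : Fin 2) :
      Integrable (fun x => (k.jac x i j : 𝕜) * u x) (volume.restrict k.U) := by
    refine hu.bdd_mul (c := C) (hjm i j) ?_
    filter_upwards [k.ae_differentiableAt, hUm] with x hd hx
    rw [RCLike.norm_ofReal]
    exact hC x hx hd i j
  obtain ⟨B, hB⟩ := hc.exists_bound_of_continuous hφ.continuous
  have hDφ (j : Fin 2) : Continuous fun x => fderiv ℝ φ x (e2 j) :=
    ((hφ.fderiv_right (m := ∞) (by simp)).clm_apply contDiff_const).continuous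
  have hDb (j : Fin 2) : ∃ B, ∀ x, |fderiv ℝ φ x (e2 j)| ≤ B :=
    (hc.fderiv_apply ℝ (e2 j)).exists_bound_of_continuous (hDφ j)
  have hgi (j : Fin 2) : Integrable (fun x => k.cov x (q (k.inv x)) j) (volume.restrict k.U) :=
    (EuclideanSpace.proj (𝕜 := 𝕜) j : V2 𝕜 →L[𝕜] 𝕜).integrable_comp (k.integrable_of_memLp hgU)
  have hI1 (j : Fin 2) : Integrable (fun x => (φ x : 𝕜) * k.cov x (q (k.inv x)) j)
      (volume.restrict k.U) :=
    integrable_ofReal_mul (hgi j) hφ.continuous.aestronglyMeasurable hB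
  have hI2 (j : Fin 2) : Integrable (fun x => ((fderiv ℝ φ x (e2 j) : ℝ) : 𝕜) * f (k.inv x))
      (volume.restrict k.U) :=
    integrable_ofReal_mul (k.integrable_of_memLp hfU) (hDφ j).aestronglyMeasurable
      (hDb j).choose_spec
  have hK1 (i : Fin 3) : Integrable (fun x =>
      (k.jac x i 1 : 𝕜) * ((φ x : 𝕜) * k.cov x (q (k.inv x)) 0)
        - (k.jac x i 0 : 𝕜) * ((φ x : 𝕜) * k.cov x (q (k.inv x)) 1)) (volume.restrict k.U) :=
    (hjb (hI1 0) i 1).sub (hjb (hI1 1) i 0)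
  have hK2 (i : Fin 3) : Integrable (fun x =>
      (k.jac x i 1 : 𝕜) * (((fderiv ℝ φ x (e2 0) : ℝ) : 𝕜) * f (k.inv x))
        - (k.jac x i 0 : 𝕜) * (((fderiv ℝ φ x (e2 1) : ℝ) : 𝕜) * f (k.inv x)))
      (volume.restrict k.U) :=
    (hjb (hI2 0) i 1).sub (hjb (hI2 1) i 0)
  have key' (i : Fin 3) : ∫ x in k.U, ((k.jac x i 1 : 𝕜) * ((φ x : 𝕜) * k.cov x (q (k.inv x)) 0)
        - (k.jac x i 0 : 𝕜) * ((φ x : 𝕜) * k.cov x (q (k.inv x)) 1))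
      = -∫ x in k.U, ((k.jac x i 1 : 𝕜) * (((fderiv ℝ φ x (e2 0) : ℝ) : 𝕜) * f (k.inv x))
        - (k.jac x i 0 : 𝕜) * (((fderiv ℝ φ x (e2 1) : ℝ) : 𝕜) * f (k.inv x))) := by
    have e := key i
    have e1 : ∫ x in k.U, (ψ (k.inv x) : 𝕜) * ((k.jac x i 1 : 𝕜) * k.cov x (q (k.inv x)) 0
        - (k.jac x i 0 : 𝕜) * k.cov x (q (k.inv x)) 1)
        = ∫ x in k.U, ((k.jac x i 1 : 𝕜) * ((φ x : 𝕜) * k.cov x (q (k.inv x)) 0)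
        - (k.jac x i 0 : 𝕜) * ((φ x : 𝕜) * k.cov x (q (k.inv x)) 1)) := by
      refine integral_congr_ae ?_
      filter_upwards [hUm] with x hx
      rw [hψφ x hx]
      ring
    have e2 : ∫ x in k.U, ((fderiv ℝ (fun y => ψ (k.inv y)) x (e2 0) * k.jac x i 1
        - fderiv ℝ (fun y => ψ (k.inv y)) x (e2 1) * k.jac x i 0 : ℝ) : 𝕜) * f (k.inv x)
        = ∫ x in k.U, ((k.jac x i 1 : 𝕜) * (((fderiv ℝ φ x (e2 0) : ℝ) : 𝕜) * f (k.inv x))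
        - (k.jac x i 0 : 𝕜) * (((fderiv ℝ φ x (e2 1) : ℝ) : 𝕜) * f (k.inv x))) := by
      refine integral_congr_ae ?_
      filter_upwards [hUm] with x hx
      rw [hdφ hx, hdφ hx]
      push_cast
      ring
    rwa [e1, e2] at e
  -- The slope enters `∂ⱼk⁻¹` only along `v`, which is orthogonal to `w l`. As `w l` does not depend
  -- on `x`, contracting with it commutes with the integral.
  have hdot {x : E2} (hd : DifferentiableAt ℝ k.patch.a x) (l j : Fin 2) :
      ∑ i, (k.patch.w l i : 𝕜) * (k.jac x i j : 𝕜) = if l = j then 1 else 0 := by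
    have h0 := k.patch.sum_sq_w0
    have h1 := k.patch.sum_sq_w1
    have h01 := k.patch.sum_w0_w1
    have hv := k.patch.sum_w_v l
    have : k.patch.w l 0 * k.jac x 0 j + k.patch.w l 1 * k.jac x 1 j
        + k.patch.w l 2 * k.jac x 2 j = if l = j then 1 else 0 := by
      simp only [k.jac_apply hd]
      fin_cases l <;> fin_cases j <;> simp at hv ⊢
      · linear_combination h0 + k.slope x 0 * hv
      · linear_combination h01 + k.slope x 1 * hv
      · linear_combination h01 + k.slope x 0 * hv
      · linear_combination h1 + k.slope x 1 * hv
    rw [Fin.sum_univ_three]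
    have := congrArg (RCLike.ofReal (K := 𝕜)) this
    push_cast at this
    rw [this]
    split_ifs <;> simp
  have hsum (l : Fin 2) : ∫ x in k.U, ∑ i, (k.patch.w l i : 𝕜) *
        ((k.jac x i 1 : 𝕜) * ((φ x : 𝕜) * k.cov x (q (k.inv x)) 0)
        - (k.jac x i 0 : 𝕜) * ((φ x : 𝕜) * k.cov x (q (k.inv x)) 1))
      = -∫ x in k.U, ∑ i, (k.patch.w l i : 𝕜) *
        ((k.jac x i 1 : 𝕜) * (((fderiv ℝ φ x (e2 0) : ℝ) : 𝕜) * f (k.inv x))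
        - (k.jac x i 0 : 𝕜) * (((fderiv ℝ φ x (e2 1) : ℝ) : 𝕜) * f (k.inv x))) := by
    rw [integral_finsetSum _ fun i _ => (hK1 i).const_mul _,
      integral_finsetSum _ fun i _ => (hK2 i).const_mul _, ← Finset.sum_neg_distrib]
    refine Finset.sum_congr rfl fun i _ => ?_
    rw [integral_const_mul, integral_const_mul, key' i, mul_neg]
  have hpt {x : E2} (hd : DifferentiableAt ℝ k.patch.a x) (l : Fin 2) (a b : 𝕜) :
      ∑ i, (k.patch.w l i : 𝕜) * ((k.jac x i 1 : 𝕜) * a - (k.jac x i 0 : 𝕜) * b)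
        = (if l = 1 then 1 else 0) * a - (if l = 0 then 1 else 0) * b := by
    rw [← hdot hd l 1, ← hdot hd l 0, Finset.sum_mul, Finset.sum_mul, ← Finset.sum_sub_distrib]
    exact Finset.sum_congr rfl fun i _ => by ring
  have hfin (l : Fin 2) : ∫ x in k.U, ((if l = 1 then 1 else 0) *
        ((φ x : 𝕜) * k.cov x (q (k.inv x)) 0)
        - (if l = 0 then 1 else 0) * ((φ x : 𝕜) * k.cov x (q (k.inv x)) 1))
      = -∫ x in k.U, ((if l = 1 then 1 else 0) *
        (((fderiv ℝ φ x (e2 0) : ℝ) : 𝕜) * f (k.inv x))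
        - (if l = 0 then 1 else 0) * (((fderiv ℝ φ x (e2 1) : ℝ) : 𝕜) * f (k.inv x))) := by
    refine Eq.trans (integral_congr_ae ?_) ((hsum l).trans (congrArg _ (integral_congr_ae ?_)))
    · filter_upwards [k.ae_differentiableAt] with x hd
      exact (hpt hd l _ _).symm
    · filter_upwards [k.ae_differentiableAt] with x hd
      exact hpt hd l _ _
  intro j
  -- The indices are crossed: contraction with `w 1` yields the equation for the derivative in
  -- direction `0`, and contraction with `w 0` the one in direction `1`.
  have f0 := hfin 0
  have f1 := hfin 1
  simp [integral_neg] at f0 f1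
  fin_cases j
  · simp only [Fin.zero_eta]
    rw [f1, neg_neg]
  · simp only [Fin.mk_one]
    rw [← f0]

end Chart

end LocalForm

section Comparison

variable {𝕜 : Type*} [RCLike 𝕜] {Ω : Set E3}

/-! ### Comparison of the two notions of tangential gradient -/

namespace Chart

variable (k : Chart Ω)

theorem measurable_pinv (i : Fin 3) (j : Fin 2) : Measurable fun x => (k.pinv x)ᵀ i j := by
  have h := k.measurable_jac
  simp only [pinv_transpose]
  simp only [Matrix.mul_apply, Matrix.inv_def, Ring.inverse_eq_inv',
    Matrix.smul_apply, Matrix.det_fin_two, Matrix.transpose_apply, Fin.sum_univ_three,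
    Fin.sum_univ_two, smul_eq_mul]
  fin_cases j <;> simp [Matrix.adjugate_fin_two, Matrix.mul_apply, Fin.sum_univ_three] <;> fun_prop

theorem memLp_vec {g : E2 → V2 𝕜} (hg : MemLp g 2 (volume.restrict k.U)) :
    MemLp (fun x => k.vec x (g x)) 2 (volume.restrict k.U) := by
  rw [memLp_piLp_iff]
  intro i
  suffices h : MemLp (fun x => ∑ j, ((k.pinv x)ᵀ i j : 𝕜) * g x j) 2 (volume.restrict k.U) from h
  refine memLp_finsetSum _ fun j _ => ?_
  have hgj : MemLp (fun x => g x j) 2 (volume.restrict k.U) := (memLp_piLp_iff.1 hg) j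
  have hm : AEStronglyMeasurable (fun x => ((k.pinv x)ᵀ i j : 𝕜)) (volume.restrict k.U) :=
    RCLike.continuous_ofReal.comp_aestronglyMeasurable (k.measurable_pinv i j).aestronglyMeasurable
  refine hgj.of_le_mul (c := 1) (hm.mul hgj.1) ?_
  filter_upwards [k.ae_differentiableAt] with x h
  rw [norm_mul, RCLike.norm_ofReal]
  exact mul_le_mul_of_nonneg_right (k.abs_pinv_transpose_le h i j) (norm_nonneg _)

/-- The tangential field on the chart domain with covariant components `g`, extended by zero. -/
def field (g : E2 → V2 𝕜) : E3 → V3 𝕜 :=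
  k.dom.indicator fun ζ => k.vec (k.coord ζ) (g (k.coord ζ))

theorem field_inv (g : E2 → V2 𝕜) {x : E2} (hx : x ∈ k.U) :
    k.field g (k.inv x) = k.vec x (g x) := by
  rw [field, indicator_of_mem (k.inv_mem_dom.2 hx), coord_inv]

theorem memLp_field (hΩ : IsStrongLipschitzDomain Ω) {g : E2 → V2 𝕜}
    (hg : MemLp g 2 (volume.restrict k.U)) : MemLp (k.field g) 2 (surfaceMeasure Ω) := by
  rw [field, memLp_indicator_iff_restrict k.measurableSet_dom, k.surfaceMeasure_restrict_dom hΩ]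
  exact k.memLp_comp_coord (k.memLp_vec hg)

theorem ae_dotV_field (hΩ : IsStrongLipschitzDomain Ω) (g : E2 → V2 𝕜) :
    ∀ᵐ ζ ∂surfaceMeasure Ω, dotV (LipBdry.normal Ω ζ) (k.field g ζ) = 0 := by
  have h : ∀ᵐ ζ ∂k.measure, dotV (LipBdry.normal Ω ζ) (k.field g ζ) = 0 := by
    rw [k.ae_measure_iff]
    filter_upwards [k.ae_differentiableAt, k.ae_normal_inv hΩ,
      ae_restrict_mem k.isOpen_U.measurableSet] with x hd hn hx
    rw [hn, k.field_inv g hx, k.dotV_vec hd]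
  rw [← k.surfaceMeasure_restrict_dom hΩ, ae_restrict_iff' k.measurableSet_dom] at h
  filter_upwards [h] with ζ hζ
  by_cases hm : ζ ∈ k.dom
  · exact hζ hm
  · rw [field, indicator_of_notMem hm]
    simp [dotV]

theorem hasTangGradOn_field (hΩ : IsStrongLipschitzDomain Ω) {f : E3 → 𝕜}
    (hf : AEStronglyMeasurable f (surfaceMeasure Ω)) {g : E2 → V2 𝕜}
    (hg : IsH1WithGrad k.U (fun x => f (k.inv x)) g) : HasTangGradOn Ω k.cyl f (k.field g) := by
  refine k.hasTangGradOn_cyl hΩ hf (k.memLp_field hΩ hg.2.1).1 hg ?_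
  filter_upwards [k.ae_differentiableAt, ae_restrict_mem k.isOpen_U.measurableSet] with x hd hx
  rw [k.field_inv g hx, k.cov_vec hd]

end Chart

/-! ### Equivalence of the two gradients, uniqueness, and gluing. -/

theorem isTangGrad_iff {f : L2 𝕜 Ω} {q : L2Vec 𝕜 Ω} : IsTangGrad Ω f q ↔ ∀ k : Chart Ω,
    ∃ g : E2 → V2 𝕜, IsH1WithGrad k.U (fun x => f (k.inv x)) g ∧
      ∀ᵐ x ∂(volume.restrict k.U), q (k.inv x) = k.vec x (g x) := by
  refine forall_congr' fun k => exists_congr fun g => and_congr_right fun _ =>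
    eventually_congr (Eventually.of_forall fun x => ?_)
  exact ⟨fun h => by ext i; exact h i, fun h i => by rw [h]; rfl⟩

theorem isWeakTangGrad_iff (hΩ : IsStrongLipschitzDomain Ω) {f : L2 𝕜 Ω} {q : L2Vec 𝕜 Ω} :
    IsWeakTangGrad Ω f q ↔
      (∀ᵐ ζ ∂surfaceMeasure Ω, dotV (normal Ω ζ) (q ζ) = 0) ∧ HasTangGradOn Ω univ f q :=
  and_congr_right fun _ => ⟨hasTangGradOn_of_forall_field, fun h _ hΦ hc =>
    integral_field_eq hΩ (Lp.memLp f) (Lp.memLp q) h hΦ hc⟩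

/-- The chart-defined and the weakly defined tangential gradients are the same. -/
theorem isTangGrad_iff_isWeakTangGrad (hΩ : IsStrongLipschitzDomain Ω) {f : L2 𝕜 Ω}
    {q : L2Vec 𝕜 Ω} : IsTangGrad Ω f q ↔ IsWeakTangGrad Ω f q := by
  rw [isWeakTangGrad_iff hΩ, isTangGrad_iff]
  constructor
  · intro h
    refine ⟨ae_of_forall_chart fun k => ?_, hasTangGradOn_univ hΩ (Lp.memLp f) (Lp.memLp q)
      fun k => ?_⟩
    · obtain ⟨g, -, hq⟩ := h k
      rw [k.ae_measure_iff]
      filter_upwards [hq, k.ae_differentiableAt, k.ae_normal_inv hΩ] with x hx hd hn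
      rw [hn, hx, k.dotV_vec hd]
    · obtain ⟨g, hg, hq⟩ := h k
      refine k.hasTangGradOn_cyl hΩ (Lp.memLp f).1 (Lp.memLp q).1 hg ?_
      filter_upwards [hq, k.ae_differentiableAt] with x hx hd
      rw [hx, k.cov_vec hd]
  · rintro ⟨ht, hw⟩ k
    -- The gradient in the chart is `Jᵀ (q ∘ k⁻¹)`; tangentiality lets `(J†)ᵀ` recover `q` from it.
    refine ⟨_, k.isH1WithGrad_of_hasTangGradOn hΩ (Lp.memLp f) (Lp.memLp q)
      (hw.mono (subset_univ _)), ?_⟩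
    filter_upwards [k.ae_differentiableAt, k.ae_normal_inv hΩ, k.ae_inv_of_ae hΩ ht] with x hd hn hx
    rw [hn] at hx
    exact (k.vec_cov hd _ hx).symm

theorem IsWeakTangGrad.unique (hΩ : IsStrongLipschitzDomain Ω) {f : L2 𝕜 Ω} {q r : L2Vec 𝕜 Ω}
    (hq : IsWeakTangGrad Ω f q) (hr : IsWeakTangGrad Ω f r) : q = r := by
  rw [isWeakTangGrad_iff hΩ] at hq hr
  refine Lp.ext ?_
  filter_upwards [hq.2.ae_unique hΩ isOpen_univ (Lp.memLp q) (Lp.memLp r) hq.1 hr.1 hr.2]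
    with ζ hζ
  exact hζ (mem_univ ζ)

/-- The role of compactness: finitely many local fields in `L²` glue to a field in `L²`, whereas
over infinitely many charts the norms need not be summable. -/
theorem exists_finset_chart_cover (hΩ : IsStrongLipschitzDomain Ω) (hc : IsCompact (frontier Ω)) :
    ∃ s : Finset (Chart Ω), ∀ ζ ∈ frontier Ω, ∃ k ∈ s, ζ ∈ k.dom := by
  obtain ⟨s, hs⟩ := hc.elim_finite_subcover (fun k : Chart Ω => k.cyl) (fun k => k.isOpen_cyl)
    fun ζ hζ => by
      obtain ⟨k, hk⟩ := exists_chart hΩ hζ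
      exact mem_iUnion.2 ⟨k, k.dom_subset_cyl hk⟩
  refine ⟨s, fun ζ hζ => ?_⟩
  obtain ⟨k, hk, hζk⟩ := mem_iUnion₂.1 (hs hζ)
  exact ⟨k, hk, k.dom_eq ▸ ⟨hζ, hζk⟩⟩

/-- Over a compact boundary the gradients in the charts glue to a square integrable field. -/
theorem exists_isTangGrad_of_isCompact (hΩ : IsStrongLipschitzDomain Ω)
    (hc : IsCompact (frontier Ω)) {f : L2 𝕜 Ω} (hf : f ∈ strongH1 𝕜 Ω) :
    ∃ q : L2Vec 𝕜 Ω, IsTangGrad Ω f q := by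
  classical
  choose g hg using hf
  -- On the intersection of the cylinders both fields are tangential weak gradients of `f`, so
  -- uniqueness identifies them.
  have hag (k m : Chart Ω) : ∀ᵐ ζ ∂surfaceMeasure Ω, ζ ∈ k.dom → ζ ∈ m.dom →
      k.field (g k) ζ = m.field (g m) ζ := by
    have := HasTangGradOn.ae_unique hΩ (k.isOpen_cyl.inter m.isOpen_cyl)
      (k.memLp_field hΩ (hg k).2.1) (m.memLp_field hΩ (hg m).2.1)
      (k.ae_dotV_field hΩ _) (m.ae_dotV_field hΩ _)
      ((k.hasTangGradOn_field hΩ (Lp.memLp f).1 (hg k)).mono inter_subset_left)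
      ((m.hasTangGradOn_field hΩ (Lp.memLp f).1 (hg m)).mono inter_subset_right)
    filter_upwards [this] with ζ h hk hm
    exact h ⟨k.dom_subset_cyl hk, m.dom_subset_cyl hm⟩
  have hglue (s : Finset (Chart Ω)) : ∃ Q : E3 → V3 𝕜, MemLp Q 2 (surfaceMeasure Ω) ∧
      ∀ k ∈ s, ∀ᵐ ζ ∂surfaceMeasure Ω, ζ ∈ k.dom → Q ζ = k.field (g k) ζ := by
    induction s using Finset.induction_on with
    | empty => exact ⟨0, MemLp.zero, by simp⟩
    | insert k s _ ih =>
      obtain ⟨Q, hQ, hQs⟩ := ih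
      -- The new chart overrides the earlier field on its domain, which by `hag` changes it only on
      -- a null set of the earlier domains.
      refine ⟨k.dom.piecewise (k.field (g k)) Q, MemLp.piecewise k.measurableSet_dom
        ((k.memLp_field hΩ (hg k).2.1).restrict _) (hQ.restrict _), fun m hm => ?_⟩
      rcases Finset.mem_insert.1 hm with rfl | hm
      · exact Eventually.of_forall fun ζ hζ => piecewise_eq_of_mem _ _ _ hζ
      · filter_upwards [hQs m hm, hag k m] with ζ h1 h2 hζ
        by_cases hk : ζ ∈ k.dom
        · rw [piecewise_eq_of_mem _ _ _ hk, h2 hk hζ]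
        · rw [piecewise_eq_of_notMem _ _ _ hk, h1 hζ]
  obtain ⟨s, hs⟩ := exists_finset_chart_cover hΩ hc
  obtain ⟨Q, hQ, hQs⟩ := hglue s
  refine ⟨hQ.toLp Q, isTangGrad_iff.2 fun k => ⟨g k, hg k, ?_⟩⟩
  -- The chart `k` need not belong to `s`; its field is compared with `Q` through the charts of `s`
  -- that cover its domain.
  have h1 : ∀ᵐ ζ ∂surfaceMeasure Ω, ∀ m ∈ s, (ζ ∈ m.dom → Q ζ = m.field (g m) ζ) ∧
      (ζ ∈ k.dom → ζ ∈ m.dom → k.field (g k) ζ = m.field (g m) ζ) := by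
    rw [Finset.eventually_all]
    exact fun m hm => (hQs m hm).and (hag k m)
  filter_upwards [k.ae_inv_of_ae hΩ h1, k.ae_inv_of_ae hΩ hQ.coeFn_toLp,
    ae_restrict_mem k.isOpen_U.measurableSet] with x hx hxQ hU
  obtain ⟨m, hm, hxm⟩ := hs _ (k.inv_mem_frontier hU)
  rw [hxQ, (hx m hm).1 hxm, ← (hx m hm).2 (k.inv_mem_dom.2 hU) hxm, k.field_inv _ hU]

theorem weakH1_eq (hΩ : IsStrongLipschitzDomain Ω) :
    weakH1 𝕜 Ω = {f | f ∈ strongH1 𝕜 Ω ∧ ∃ q : L2Vec 𝕜 Ω, IsTangGrad Ω f q} := by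
  ext f
  constructor
  · rintro ⟨q, hq⟩
    have h := (isTangGrad_iff_isWeakTangGrad hΩ).2 hq
    exact ⟨fun k => (h k).imp fun _ hg => hg.1, q, h⟩
  · rintro ⟨-, q, hq⟩
    exact ⟨q, (isTangGrad_iff_isWeakTangGrad hΩ).1 hq⟩

end Comparison

end LipBdry

end

theorem mainTheorem1 {𝕜 : Type*} [RCLike 𝕜] (Ω : Set LipBdry.E3)
    (hΩ : LipBdry.IsStrongLipschitzDomain Ω) :
    (IsCompact (frontier Ω) → LipBdry.weakH1 𝕜 Ω = LipBdry.strongH1 𝕜 Ω) ∧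
    LipBdry.weakH1 𝕜 Ω
      = {f | f ∈ LipBdry.strongH1 𝕜 Ω ∧ ∃ q : LipBdry.L2Vec 𝕜 Ω, LipBdry.IsTangGrad Ω f q} ∧
    ∀ f ∈ LipBdry.weakH1 𝕜 Ω, ∃ q : LipBdry.L2Vec 𝕜 Ω,
      (∀ g : LipBdry.L2Vec 𝕜 Ω, LipBdry.IsTangGrad Ω f g ↔ g = q) ∧
      (∀ g : LipBdry.L2Vec 𝕜 Ω, LipBdry.IsWeakTangGrad Ω f g ↔ g = q) := by
  refine ⟨fun hc => ?_, LipBdry.weakH1_eq hΩ, ?_⟩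
  · rw [LipBdry.weakH1_eq hΩ]
    exact Set.Subset.antisymm (fun f hf => hf.1)
      fun f hf => ⟨hf, LipBdry.exists_isTangGrad_of_isCompact hΩ hc hf⟩
  · rintro f ⟨q, hq⟩
    have hw : ∀ g : LipBdry.L2Vec 𝕜 Ω, LipBdry.IsWeakTangGrad Ω f g ↔ g = q := fun g =>
      ⟨fun hg => hg.unique hΩ hq, fun hg => hg ▸ hq⟩
    exact ⟨q, fun g => (LipBdry.isTangGrad_iff_isWeakTangGrad hΩ).trans (hw g), hw⟩
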